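/- Let $\mathfrak g$ be a finite-dimensional simple complex Lie algebra with basis $\{x_a\}$ and structure constants $\alpha_{ab}^{\ \ c}$, so that $[x_a,x_b]=\sum_c\alpha_{ab}^{\ \ c}x_c$. Let $\mathfrak g[u]=\mathfrak g\otimes\mathbb C[u]$ be the half-loop Lie algebra, with bracket $[x\otimes u^k,y\otimes u^l]=[x,y]\otimes u^{k+l}$, and write $x_a^{(k)}=x_a\otimes u^k$. (1) Let $\mathcal D$ be the complex Lie algebra generated by symbols $x_a$ (one for each basis index $a$) and $J(v)$ (one for each $v\in\mathfrak g$), subject to the following defining relations, for all basis indices $a,b,c,d$, all $v,w\in\mathfrak g$ and all $\mu,\nu\in\mathbb C$: level 0 and level 1: $$[x_a,x_b]=\sum_c\alpha_{ab}^{\ \ c}\,x_c,\qquad J(\mu v+\nu w)=\mu J(v)+\nu J(w),\qquad [x_a,J(x_b)]=\sum_c\alpha_{ab}^{\ \ c}\,J(x_c);$$ level 2 (relation (DL2)): $$[J(x_a),J([x_b,x_c])]+[J(x_b),J([x_c,x_a])]+[J(x_c),J([x_a,x_b])]=0;$$ level 3 (relation (DL3)): $$[[J(x_a),J(x_b)],J([x_c,x_d])]+[[J(x_c),J(x_d)],J([x_a,x_b])]=0.$$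 Here, inside $J(\cdot)$, $x_a$ and $[x_b,x_c]$ denote the corresponding elements of $\mathfrak g$. Then there is an isomorphism of complex Lie algebras $\mathcal D\to\mathfrak g[u]$ with $x_a\mapsto x_a^{(0)}$ and $J(x_a)\mapsto x_a^{(1)}$ for every $a$. (2) If $\operatorname{rank}(\mathfrak g)=1$, the level-2 relation is trivial: for every complex Lie algebra $A$ and every linear map $J:\mathfrak g\to A$, the level-2 relation (DL2) holds in $A$ for all $a,b,c$. (3) If $\operatorname{rank}(\mathfrak g)\ge 2$, the level-3 relation follows from the level-2 relation: whenever elements $x_a$ and $J(v)$ ($v\in\mathfrak g$) of a complex Lie algebra $A$ satisfy the level-0 and level-1 relations and (DL2), they also satisfy (DL3). -/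

import Mathlib

open scoped TensorProduct Polynomial

universe u v w

noncomputable section

namespace HalfLoop

/-- The half-loop Lie algebra `g[u] = g ⊗ ℂ[u]` of polynomial maps `ℂ → g`, with the bracket
`⁅p ⊗ y, q ⊗ z⁆ = (p * q) ⊗ ⁅y, z⁆` (the coefficient polynomial is written on the left). -/
abbrev LoopAlg (g : Type u) [LieRing g] [LieAlgebra ℂ g] : Type u :=
  ℂ[X] ⊗[ℂ] g

/-- The element `y⁽ᵏ⁾ = y ⊗ uᵏ` of `g[u]`. -/
def loopElt {g : Type u} [LieRing g] [LieAlgebra ℂ g] (k : ℕ) (y : g) : LoopAlg g :=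
  ((Polynomial.X : ℂ[X]) ^ k) ⊗ₜ[ℂ] y

section Expressions

variable {g : Type u} [LieRing g] [LieAlgebra ℂ g]

/-- The structure constants of `g` in the basis `b`: `⁅b i, b j⁆ = ∑ k, α i j k • b k`. -/
def structConst {ι : Type v} (b : Module.Basis ι ℂ g) (i j k : ι) : ℂ :=
  b.repr ⁅b i, b j⁆ k

/-- The left-hand side of the level-2 loop terrific relation,
`[J(p), J([q, r])] + [J(q), J([r, p])] + [J(r), J([p, q])]`. -/
def level2Expr {A : Type w} [LieRing A] (J : g → A) (p q r : g) : A :=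
  ⁅J p, J ⁅q, r⁆⁆ + ⁅J q, J ⁅r, p⁆⁆ + ⁅J r, J ⁅p, q⁆⁆

/-- The left-hand side of the level-3 loop terrific relation,
`[[J(p), J(q)], J([r, s])] + [[J(r), J(s)], J([p, q])]`. -/
def level3Expr {A : Type w} [LieRing A] (J : g → A) (p q r s : g) : A :=
  ⁅⁅J p, J q⁆, J ⁅r, s⁆⁆ + ⁅⁅J r, J s⁆, J ⁅p, q⁆⁆

/-- Families `x a` (indexed by a basis `b` of `g`) and `J v` (for `v` in `g`) of elements of a Lie
algebra `A` satisfy the level-0 and level-1 relations. -/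
structure Level01 {ι : Type v} [Fintype ι] (b : Module.Basis ι ℂ g)
    {A : Type w} [LieRing A] [LieAlgebra ℂ A] (x : ι → A) (J : g → A) : Prop where
  lie_x_x : ∀ i j : ι, ⁅x i, x j⁆ = ∑ k, structConst b i j k • x k
  J_linear : ∀ (μ ν : ℂ) (p q : g), J (μ • p + ν • q) = μ • J p + ν • J q
  lie_x_J : ∀ i j : ι, ⁅x i, J (b j)⁆ = ∑ k, structConst b i j k • J (b k)

/-- The level-2 loop terrific relation holds for all elements of the basis `b`. -/
def Level2 {ι : Type v} (b : Module.Basis ι ℂ g) {A : Type w} [LieRing A] (J : g → A) : Prop :=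
  ∀ i j k : ι, level2Expr J (b i) (b j) (b k) = 0

/-- The level-3 loop terrific relation holds for all elements of the basis `b`. -/
def Level3 {ι : Type v} (b : Module.Basis ι ℂ g) {A : Type w} [LieRing A] (J : g → A) : Prop :=
  ∀ i j k l : ι, level3Expr J (b i) (b j) (b k) (b l) = 0

end Expressions

/-- The generating symbols: `x a` for each basis index `a`, and `J(v)` for each `v` in `g`. -/
inductive Gen (ι : Type v) (g : Type u) : Type (max u v)
  | x : ι → Gen ι g
  | J : g → Gen ι g

section Presentation

variable {g : Type u} [LieRing g] [LieAlgebra ℂ g] {ι : Type v} [Fintype ι]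

/-- The generator `x a` in the free Lie algebra. -/
def freeX (g : Type u) (a : ι) : FreeLieAlgebra ℂ (Gen ι g) :=
  FreeLieAlgebra.of ℂ (Gen.x a)

/-- The generator `J(v)` in the free Lie algebra. -/
def freeJ (ι : Type v) (v : g) : FreeLieAlgebra ℂ (Gen ι g) :=
  FreeLieAlgebra.of ℂ (Gen.J v)

/-- The relators: the element `r` of the free Lie algebra satisfies `Relator b r` if `r = 0` is one
of the defining relations (level 0, linearity of `J`, level 1, level 2, level 3). -/
inductive Relator (b : Module.Basis ι ℂ g) : FreeLieAlgebra ℂ (Gen ι g) → Prop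
  | level0 (i j : ι) :
      Relator b (⁅freeX g i, freeX g j⁆ - ∑ k, structConst b i j k • freeX g k)
  | linear (μ ν : ℂ) (p q : g) :
      Relator b (freeJ ι (μ • p + ν • q) - (μ • freeJ ι p + ν • freeJ ι q))
  | level1 (i j : ι) :
      Relator b (⁅freeX g i, freeJ ι (b j)⁆ - ∑ k, structConst b i j k • freeJ ι (b k))
  | level2 (i j k : ι) :
      Relator b (level2Expr (freeJ ι) (b i) (b j) (b k))
  | level3 (i j k l : ι) :
      Relator b (level3Expr (freeJ ι) (b i) (b j) (b k) (b l))

/-- The Lie ideal of the free Lie algebra generated by the relators. -/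
def relIdeal (b : Module.Basis ι ℂ g) : LieIdeal ℂ (FreeLieAlgebra ℂ (Gen ι g)) :=
  LieSubmodule.lieSpan ℂ (FreeLieAlgebra ℂ (Gen ι g)) {r | Relator b r}

/-- The Lie algebra generated by the `x a` and `J(v)` subject to the level-0, level-1, level-2 and
level-3 relations. -/
abbrev Presented (b : Module.Basis ι ℂ g) : Type (max u v) :=
  FreeLieAlgebra ℂ (Gen ι g) ⧸ relIdeal b

/-- The generator `x a` of the presented Lie algebra. -/
def presX (b : Module.Basis ι ℂ g) (a : ι) : Presented b :=
  LieSubmodule.Quotient.mk (N := relIdeal b) (freeX g a)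

/-- The generator `J(v)` of the presented Lie algebra. -/
def presJ (b : Module.Basis ι ℂ g) (v : g) : Presented b :=
  LieSubmodule.Quotient.mk (N := relIdeal b) (freeJ ι v)

end Presentation

end HalfLoop

end

noncomputable section

namespace HalfLoop

/-! ### Simple Lie algebras are perfect -/

section Perfect

variable {K L M : Type*} [Field K] [LieRing L] [LieAlgebra K L] [AddCommGroup M] [Module K M]

/-! In any Lie algebra satisfying the relations, maps `y ↦ y⁽ⁿ⁾` are built recursively by requiring
`⁅J p, q⁽ⁿ⁺¹⁾⁆ = ⁅p, q⁆⁽ⁿ⁺²⁾`. Such a map is unique because `g` is perfect; it exists precisely when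
the left-hand side factors through the bracket of `g`. The isomorphism thus reduces to showing that
certain bilinear maps on `g` factor through the bracket, which is Whitehead's second lemma with
trivial coefficients (`exists_factor_lie_of_cocycle`).

In degree 2, (DL2) is the cocycle identity for `⁅J p, J q⁆`. In degree 3, `T p q = ⁅J p, q⁽²⁾⁆`
satisfies the cocycle identity by Jacobi, and (DL3) says that `T` is skew. In degree `N ≥ 4` Jacobi
alone suffices: the forms `⁅p⁽ⁱ⁾, q⁽ᴺ⁻ⁱ⁾⁆` make up a graded cocycle, and
`exists_killingForm_lie_of_graded_cocycle` shows, on scalar components, that all of them are one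
coboundary. This gives `lie_levels_levels`, and with it an inverse to the evident map onto `g[u]`.

In rank at least two the skewness of `T` already follows from the cocycle identity
(`IsCyclic.skew`), by computing on root spaces and splitting each root as a sum of two independent
roots. In rank one `g` is spanned by an `sl₂`-triple; the level-2 expression is alternating and
trilinear, so only its value at `(e, f, h)` matters, namely `2⁅J e, J f⁆ + 2⁅J f, J e⁆ + ⁅J h, J h⁆
= 0`. -/

lemma span_lie_eq_top_of_isSimple [LieAlgebra.IsSimple K L] :
    Submodule.span K {z : L | ∃ x y : L, ⁅x, y⁆ = z} = ⊤ := by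
  have h : ⁅(⊤ : LieIdeal K L), (⊤ : LieIdeal K L)⁆ = ⊤ := by
    refine (LieAlgebra.IsSimple.eq_bot_or_eq_top (R := K) _).resolve_left fun h ↦ ?_
    apply LieAlgebra.IsSimple.non_abelian K (L := L)
    rw [← LieSubmodule.lie_abelian_iff_lie_self_eq_bot] at h
    exact (lie_abelian_iff_equiv_lie_abelian (LieIdeal.topEquiv (R := K) (L := L))).mp h
  have := congrArg LieSubmodule.toSubmodule h
  rw [LieSubmodule.lieIdeal_oper_eq_linear_span'] at this
  simpa using this

/-- Linear maps out of a simple Lie algebra which agree on brackets are equal. -/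
lemma linearMap_ext_lie [LieAlgebra.IsSimple K L] {f g : L →ₗ[K] M}
    (h : ∀ x y : L, f ⁅x, y⁆ = g ⁅x, y⁆) : f = g := by
  refine LinearMap.ext_on (span_lie_eq_top_of_isSimple (K := K) (L := L)) ?_
  rintro _ ⟨x, y, rfl⟩
  exact h x y

end Perfect

/-! ### Scalar cocycles via the Killing form -/

section Killing

variable {K L : Type*} [Field K] [LieRing L] [LieAlgebra K L]

local notation "κ" => killingForm K L

lemma killingForm_ext [LieAlgebra.IsKilling K L] {x y : L} (h : ∀ z, κ x z = κ y z) : x = y := by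
  rw [← sub_eq_zero]
  refine (LieAlgebra.IsKilling.killingForm_nondegenerate K L).1 _ fun z ↦ ?_
  simp [h]

lemma killingForm_lie_left (x y z : L) : κ ⁅x, y⁆ z = κ x ⁅y, z⁆ :=
  LieModule.traceForm_apply_lie_apply K L L x y z

lemma killingForm_comm (x y : L) : κ x y = κ y x := LieModule.traceForm_comm K L L x y

variable [FiniteDimensional K L] [LieAlgebra.IsKilling K L]

/-- Every bilinear form is represented by an operator through the Killing form. -/
lemma exists_end_killingForm_eq (T : L →ₗ[K] L →ₗ[K] K) :
    ∃ D : L →ₗ[K] L, ∀ x y, κ (D x) y = T x y := by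
  let e := LinearMap.BilinForm.toDual κ (LieAlgebra.IsKilling.killingForm_nondegenerate K L)
  refine ⟨e.symm.toLinearMap ∘ₗ T, fun x y ↦ ?_⟩
  change e (e.symm (T x)) y = _
  rw [e.apply_symm_apply]

/-- Derivations of a Killing Lie algebra are inner. -/
lemma exists_eq_lie_of_derivation (D : L →ₗ[K] L)
    (hD : ∀ x y : L, D ⁅x, y⁆ = ⁅D x, y⁆ + ⁅x, D y⁆) : ∃ z : L, ∀ x : L, D x = ⁅z, x⁆ := by
  let D' : LieDerivation K L L := ⟨D, fun x y ↦ by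
    rw [hD, ← lie_skew (D x) y]; abel⟩
  obtain ⟨z, hz⟩ := LieDerivation.IsKilling.exists_eq_ad (R := K) (L := L) D'
  refine ⟨z, fun x ↦ ?_⟩
  have := congrArg (fun E : LieDerivation K L L ↦ E x) hz
  simpa [D'] using this.symm

/-- Whitehead's second lemma for trivial coefficients: scalar 2-cocycles are coboundaries. -/
lemma exists_killingForm_lie_of_cocycle (T : L →ₗ[K] L →ₗ[K] K)
    (hs : ∀ x y, T x y = - T y x)
    (hc : ∀ x y z : L, T x ⁅y, z⁆ + T y ⁅z, x⁆ + T z ⁅x, y⁆ = 0) :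
    ∃ z : L, ∀ x y : L, T x y = κ z ⁅x, y⁆ := by
  obtain ⟨D, hD⟩ := exists_end_killingForm_eq T
  -- Invariance of the Killing form turns the cocycle identity for `T` into the Leibniz rule for
  -- `D`.
  obtain ⟨z, hz⟩ := exists_eq_lie_of_derivation (K := K) D fun x y ↦ by
    refine killingForm_ext (K := K) fun w ↦ ?_
    have hw : T y ⁅x, w⁆ = - T y ⁅w, x⁆ := by rw [← lie_skew, map_neg]
    rw [hD, map_add, LinearMap.add_apply, killingForm_lie_left, hD, ← lie_skew x (D y), map_neg,
      LinearMap.neg_apply, killingForm_lie_left, hD, hs ⁅x, y⁆ w, hw]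
    linear_combination - hc x y w
  exact ⟨z, fun x y ↦ by rw [← hD, hz, killingForm_lie_left]⟩

end Killing

/-! ### Factoring through the bracket; centroid and quasi-centroid -/

section Factor

variable {K L M : Type*} [Field K] [LieRing L] [LieAlgebra K L] [AddCommGroup M] [Module K M]

/-- A bilinear map, all of whose scalar components factor through the bracket, factors through
the bracket. -/
lemma exists_factor_lie_of_dual [LieAlgebra.IsSimple K L] (T : L →ₗ[K] L →ₗ[K] M)
    (h : ∀ f : M →ₗ[K] K, ∃ l : L →ₗ[K] K, ∀ x y : L, f (T x y) = l ⁅x, y⁆) :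
    ∃ G : L →ₗ[K] M, ∀ x y : L, T x y = G ⁅x, y⁆ := by
  let B : L ⊗[K] L →ₗ[K] L := TensorProduct.lift (LieModule.toEnd K L L : L →ₗ[K] L →ₗ[K] L)
  have hB : ∀ x y, B (x ⊗ₜ y) = ⁅x, y⁆ := fun x y ↦ rfl
  have hsurj : LinearMap.range B = ⊤ := by
    rw [eq_top_iff, ← span_lie_eq_top_of_isSimple (K := K) (L := L), Submodule.span_le]
    rintro _ ⟨x, y, rfl⟩
    exact ⟨x ⊗ₜ y, hB x y⟩
  -- Any linear section of the bracket will do: by hypothesis every functional of `T` vanishes on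
  -- `ker B`.
  obtain ⟨σ, hσ⟩ := B.exists_rightInverse_of_surjective hsurj
  refine ⟨TensorProduct.lift T ∘ₗ σ, fun x y ↦ ?_⟩
  rw [← sub_eq_zero, ← Module.forall_dual_apply_eq_zero_iff K]
  intro f
  obtain ⟨l, hl⟩ := h f
  have key : f ∘ₗ TensorProduct.lift T = l ∘ₗ B :=
    TensorProduct.ext' fun x y ↦ by simp [hl, hB]
  have key' (t) : f (TensorProduct.lift T t) = l (B t) := LinearMap.congr_fun key t
  have hσ' (z) : B (σ z) = z := LinearMap.congr_fun hσ z
  rw [map_sub, LinearMap.comp_apply, key', hσ', hl, sub_self]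

variable [FiniteDimensional K L] [LieAlgebra.IsSimple K L]

/-- Vector-valued 2-cocycles on a simple Lie algebra factor through the bracket. -/
lemma exists_factor_lie_of_cocycle [CharZero K] (T : L →ₗ[K] L →ₗ[K] M)
    (hs : ∀ x y, T x y = - T y x)
    (hc : ∀ x y z : L, T x ⁅y, z⁆ + T y ⁅z, x⁆ + T z ⁅x, y⁆ = 0) :
    ∃ G : L →ₗ[K] M, ∀ x y : L, T x y = G ⁅x, y⁆ := by
  refine exists_factor_lie_of_dual T fun f ↦ ?_
  obtain ⟨z, hz⟩ := exists_killingForm_lie_of_cocycle (K := K) (T.compr₂ f)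
    (fun x y ↦ by simp [hs x y]) (fun x y z ↦ by
      simp only [LinearMap.compr₂_apply, ← map_add, hc, map_zero])
  exact ⟨killingForm K L z, hz⟩

/-- In a simple Lie algebra over an algebraically closed field, an operator commuting with the
adjoint action is a scalar. -/
lemma exists_eq_smul_of_centroid [IsAlgClosed K] (F : L →ₗ[K] L)
    (hF : ∀ x y : L, F ⁅x, y⁆ = ⁅x, F y⁆) : ∃ c : K, ∀ x, F x = c • x := by
  have : Nontrivial L := by
    by_contra h
    rw [not_nontrivial_iff_subsingleton] at h
    exact LieAlgebra.IsSimple.non_abelian K (L := L) ⟨fun x y ↦ Subsingleton.elim _ _⟩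
  obtain ⟨c, hc⟩ := Module.End.exists_eigenvalue (F : Module.End K L)
  let I : LieIdeal K L :=
    { Module.End.eigenspace F c with
      lie_mem := fun {x m} hm ↦ by
        have hm' : F m = c • m := Module.End.mem_eigenspace_iff.mp hm
        exact Module.End.mem_eigenspace_iff.mpr (by rw [hF, hm', lie_smul]) }
  have hI : I = ⊤ := (LieAlgebra.IsSimple.eq_bot_or_eq_top (R := K) I).resolve_left fun h ↦ by
    exact hc (congrArg LieSubmodule.toSubmodule h)
  refine ⟨c, fun x ↦ ?_⟩
  have hx : x ∈ I := hI ▸ LieSubmodule.mem_top x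
  exact Module.End.mem_eigenspace_iff.mp hx

/-- In a simple Lie algebra over an algebraically closed field, an operator in the quasi-centroid
is a scalar. -/
lemma exists_eq_smul_of_quasiCentroid [CharZero K] [IsAlgClosed K] (E : L →ₗ[K] L)
    (hE : ∀ x y : L, ⁅E x, y⁆ = ⁅x, E y⁆) : ∃ c : K, ∀ x, E x = c • x := by
  -- `F` is the Killing adjoint of `E`. It is `F` that is shown to commute with the adjoint action.
  obtain ⟨F, hF⟩ := exists_end_killingForm_eq ((killingForm K L).compl₂ E)
  simp only [LinearMap.compl₂_apply] at hF
  have h1 (x y : L) : F ⁅x, y⁆ = ⁅E x, y⁆ := by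
    refine killingForm_ext (K := K) fun w ↦ ?_
    rw [hF, killingForm_lie_left, ← hE y w, ← killingForm_lie_left, hE]
  have h2 (x y z : L) : F ⁅x, ⁅y, z⁆⁆ = ⁅F ⁅x, y⁆, z⁆ + ⁅F ⁅z, x⁆, y⁆ := by
    rw [h1 x ⁅y, z⁆, leibniz_lie, h1, ← lie_skew y, hE x z, ← lie_skew x (E z), ← h1, ← h1, neg_lie,
      neg_neg]
  -- The three cyclic forms of `h2` add up to twice a cyclic sum of `⁅F ⁅x, y⁆, z⁆`, which therefore
  -- vanishes.
  have h3 (x y z : L) : F ⁅x, ⁅y, z⁆⁆ = ⁅x, F ⁅y, z⁆⁆ := by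
    have jac : F ⁅x, ⁅y, z⁆⁆ + F ⁅y, ⁅z, x⁆⁆ + F ⁅z, ⁅x, y⁆⁆ = 0 := by
      rw [← map_add, ← map_add, lie_jacobi, map_zero]
    rw [h2 x, h2 y, h2 z] at jac
    rw [h2 x, ← lie_skew x (F ⁅y, z⁆)]
    linear_combination (norm := module) (2⁻¹ : K) • jac
  obtain ⟨c, hc⟩ := exists_eq_smul_of_centroid F fun x y ↦ by
    have := linearMap_ext_lie (f := F ∘ₗ (LieModule.toEnd K L L x : L →ₗ[K] L))
      (g := (LieModule.toEnd K L L x : L →ₗ[K] L) ∘ₗ F) (fun y z ↦ h3 x y z)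
    exact LinearMap.congr_fun this y
  refine ⟨c, fun x ↦ ?_⟩
  refine killingForm_ext (K := K) fun w ↦ ?_
  have := linearMap_ext_lie (f := killingForm K L (E x)) (g := killingForm K L (c • x)) fun y z ↦ by
    rw [← killingForm_lie_left, ← h1, hc, map_smul, map_smul, LinearMap.smul_apply, 
      LinearMap.smul_apply, killingForm_lie_left]
  rw [this]

end Factor

/-! ### Graded cocycles in total degree at least four -/

section Graded

variable {K L : Type*} [Field K] [CharZero K] [IsAlgClosed K] [LieRing L] [LieAlgebra K L]
  [FiniteDimensional K L] [LieAlgebra.IsSimple K L]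

/-- A graded family of bilinear forms in total degree `N ≥ 4` satisfying the graded versions of
skew-symmetry and of the cocycle identity consists of one and the same coboundary. -/
lemma exists_killingForm_lie_of_graded_cocycle {N : ℕ} (hN : 4 ≤ N) (T : ℕ → L →ₗ[K] L →ₗ[K] K)
    (hs : ∀ i j, 1 ≤ i → 1 ≤ j → i + j = N → ∀ x y, T i x y = - T j y x)
    (hc : ∀ i j k, 1 ≤ i → 1 ≤ j → 1 ≤ k → i + j + k = N → ∀ x y z : L,
      T i x ⁅y, z⁆ + T j y ⁅z, x⁆ + T k z ⁅x, y⁆ = 0) :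
    ∃ z : L, ∀ i, 1 ≤ i → i < N → ∀ x y : L, T i x y = killingForm K L z ⁅x, y⁆ := by
  choose D hD using fun i ↦ exists_end_killingForm_eq (T i)
  have lieD (i j : ℕ) (hi : 1 ≤ i) (hj : 1 ≤ j) (hij : i + j < N) (x y : L) :
      D (i + j) ⁅x, y⁆ = ⁅D i x, y⁆ + ⁅x, D j y⁆ := by
    refine killingForm_ext (K := K) fun w ↦ ?_
    obtain ⟨k, rfl⟩ := Nat.exists_eq_add_of_lt hij
    have hw : T j y ⁅x, w⁆ = - T j y ⁅w, x⁆ := by rw [← lie_skew, map_neg]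
    rw [hD, map_add, LinearMap.add_apply, killingForm_lie_left, hD, ← lie_skew x (D j y), map_neg,
      LinearMap.neg_apply, killingForm_lie_left, hD,
      hs (i + j) (k + 1) (by omega) (by omega) (by omega), hw]
    linear_combination - hc i j (k + 1) hi hj (by omega) (by omega) x y w
  -- `D 3 ⁅x, y⁆` is expanded as `1 + 2` and as `2 + 1`; this needs `3 < N`, whence the bound `4 ≤
  -- N`.
  obtain ⟨c, hc12⟩ : ∃ c : K, ∀ x, (D 1 - D 2) x = c • x := by
    refine exists_eq_smul_of_quasiCentroid _ fun x y ↦ ?_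
    have h1 := lieD 1 2 le_rfl (by omega) (by omega) x y
    have h2 := lieD 2 1 (by omega) le_rfl (by omega) x y
    rw [Nat.add_comm 2 1, h1] at h2
    rw [LinearMap.sub_apply, LinearMap.sub_apply, sub_lie, lie_sub, sub_eq_sub_iff_add_eq_add, h2]
    abel
  -- Since `D 2 = D 1 - c`, the rule for `D 2 ⁅x, y⁆` becomes the Leibniz rule once `D 1` is shifted
  -- by `c`.
  obtain ⟨z, hz⟩ := exists_eq_lie_of_derivation (K := K) (D 1 + c • LinearMap.id) fun x y ↦ by
    have h1 := lieD 1 1 le_rfl le_rfl (by omega) x y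
    have h2 := hc12 ⁅x, y⁆
    simp only [LinearMap.sub_apply, LinearMap.add_apply, LinearMap.smul_apply, LinearMap.id_apply,
      add_lie, lie_add, smul_lie, lie_smul] at h2 ⊢
    rw [sub_eq_iff_eq_add.mp h2, h1]
    module
  have hDi (i : ℕ) (hi : 1 ≤ i) (hiN : i < N) (x : L) : D i x = ⁅z, x⁆ - (i * c) • x := by
    induction i, hi using Nat.le_induction generalizing x with
    | base => simp [← hz]
    | succ i hi ih =>
      have := linearMap_ext_lie (f := D (i + 1))
        (g := (LieModule.toEnd K L L z : L →ₗ[K] L) - ((i + 1 : ℕ) * c) • LinearMap.id)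
        fun x y ↦ by
          have h1 : D 1 y = ⁅z, y⁆ - c • y := by rw [← hz y]; simp
          rw [lieD i 1 hi le_rfl hiN, ih (by omega), h1]
          simp only [LinearMap.sub_apply, LinearMap.smul_apply, LinearMap.id_apply,
            LieModule.toEnd_apply_apply, sub_lie, lie_sub, smul_lie,
            lie_smul, leibniz_lie z x y]
          push_cast
          module
      exact LinearMap.congr_fun this x
  -- The term `i * c` reflects the degree derivation of `g[u]`. Skewness between degrees `N - 1` and
  -- `1` forces `N * c` times the Killing form to vanish.
  have hc0 (x y : L) : c * killingForm K L x y = 0 := by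
    have h := hs (N - 1) 1 (by omega) le_rfl (by omega) x y
    rw [← hD, ← hD, hDi _ (by omega) (by omega), hDi _ le_rfl (by omega)] at h
    have hsk : killingForm K L z ⁅y, x⁆ = - killingForm K L z ⁅x, y⁆ := by
      rw [← lie_skew, map_neg]
    simp only [map_sub, map_smul, LinearMap.sub_apply, LinearMap.smul_apply, smul_eq_mul,
      killingForm_lie_left, killingForm_comm y x, hsk] at h
    have hN' : (N : K) ≠ 0 := by exact_mod_cast (by omega : N ≠ 0)
    refine (mul_eq_zero_iff_left hN').mp ?_
    rw [Nat.cast_sub (by omega)] at h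
    push_cast at h
    linear_combination -h
  refine ⟨z, fun i hi hiN x y ↦ ?_⟩
  rw [← hD, hDi i hi hiN, map_sub, map_smul, LinearMap.sub_apply, LinearMap.smul_apply,
    smul_eq_mul, mul_assoc, hc0, mul_zero, sub_zero, killingForm_lie_left]

/-- The vector-valued form of `exists_killingForm_lie_of_graded_cocycle`. -/
lemma exists_factor_lie_of_graded_cocycle {M : Type*} [AddCommGroup M] [Module K M]
    {N : ℕ} (hN : 4 ≤ N) (T : ℕ → L →ₗ[K] L →ₗ[K] M)
    (hs : ∀ i j, 1 ≤ i → 1 ≤ j → i + j = N → ∀ x y, T i x y = - T j y x)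
    (hc : ∀ i j k, 1 ≤ i → 1 ≤ j → 1 ≤ k → i + j + k = N → ∀ x y z : L,
      T i x ⁅y, z⁆ + T j y ⁅z, x⁆ + T k z ⁅x, y⁆ = 0) :
    ∃ G : L →ₗ[K] M, ∀ i, 1 ≤ i → i < N → ∀ x y : L, T i x y = G ⁅x, y⁆ := by
  have key (f : M →ₗ[K] K) : ∃ z : L, ∀ i, 1 ≤ i → i < N → ∀ x y : L,
      f (T i x y) = killingForm K L z ⁅x, y⁆ :=
    exists_killingForm_lie_of_graded_cocycle hN (fun i ↦ (T i).compr₂ f)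
      (fun i j hi hj hij x y ↦ by simp [hs i j hi hj hij x y])
      (fun i j k hi hj hk h x y z ↦ by
        simp only [LinearMap.compr₂_apply, ← map_add, hc i j k hi hj hk h, map_zero])
  obtain ⟨G, hG⟩ := exists_factor_lie_of_dual (T 1) fun f ↦ by
    obtain ⟨z, hz⟩ := key f
    exact ⟨killingForm K L z, hz 1 le_rfl (by omega)⟩
  refine ⟨G, fun i hi hiN x y ↦ ?_⟩
  rw [← hG, ← sub_eq_zero, ← Module.forall_dual_apply_eq_zero_iff K]
  intro f
  obtain ⟨z, hz⟩ := key f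
  rw [map_sub, hz i hi hiN, hz 1 le_rfl (by omega), sub_self]

end Graded

/-! ### Cyclic bilinear maps on root spaces -/

section Roots

open LieAlgebra LieModule LieAlgebra.IsKilling

variable {K L M : Type*} [Field K] [LieRing L] [LieAlgebra K L]
  [FiniteDimensional K L] [IsKilling K L]
  {H : LieSubalgebra K L} [H.IsCartanSubalgebra] [IsTriangularizable K H L]

lemma exists_killingForm_eq_one (α : Weight K H L) :
    ∃ u ∈ rootSpace H α, ∃ v ∈ rootSpace H (-α), u ≠ 0 ∧ v ≠ 0 ∧ killingForm K L u v = 1 := by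
  obtain ⟨u, hu, hu0⟩ := α.exists_ne_zero
  obtain ⟨v, hv, hκ⟩ : ∃ v ∈ rootSpace H (-α), killingForm K L u v ≠ 0 := by
    by_contra! hcon
    have := mem_ker_killingForm_of_mem_rootSpace_of_forall_rootSpace_neg K L H hu hcon
    rw [ker_killingForm_eq_bot] at this
    exact hu0 (by simpa using this)
  refine ⟨u, hu, (killingForm K L u v)⁻¹ • v, Submodule.smul_mem _ _ hv, hu0, ?_, ?_⟩
  · refine smul_ne_zero (inv_ne_zero hκ) ?_
    rintro rfl
    simp at hκ
  · rw [map_smul, smul_eq_mul, inv_mul_cancel₀ hκ]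

variable [CharZero K]

/-- Two functions on `H` are jointly surjective onto `K × K`. For weights this is linear
independence. -/
def JointlySurjective (α β : H → K) : Prop := ∀ a b : K, ∃ h : H, α h = a ∧ β h = b

/-- Proportional roots agree up to sign, and two non-proportional functionals take arbitrary pairs
of values. -/
lemma eq_or_eq_neg_or_jointlySurjective {α β : Weight K H L} (hα : α.IsNonZero)
    (hβ : β.IsNonZero) : β = -α ∨ β = α ∨ JointlySurjective (H := H) α β := by
  by_cases h : ∃ k : K, (β : H → K) = k • (α : H → K)
  · obtain ⟨k, hk⟩ := h
    rcases eq_neg_or_eq_of_eq_smul α β hβ k hk with h | h <;> simp [h]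
  refine .inr (.inr ?_)
  have aux {φ ψ : H →ₗ[K] K} (h : ¬ ∃ k : K, ψ = k • φ) : ∃ x, φ x = 0 ∧ ψ x = 1 := by
    by_contra! hx
    refine h ?_
    have hle : LinearMap.ker φ ≤ LinearMap.ker ψ := fun x hx' ↦ by
      by_contra hψ
      have hψ' : ψ x ≠ 0 := hψ
      refine hx ((ψ x)⁻¹ • x) ?_ ?_
      · rw [map_smul, LinearMap.mem_ker.mp hx', smul_zero]
      · rw [map_smul, smul_eq_mul, inv_mul_cancel₀ hψ']
    have := mem_span_of_iInf_ker_le_ker (L := fun _ : Unit ↦ φ) (K := ψ) (by simpa using hle)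
    simp only [Set.range_const] at this
    obtain ⟨k, hk⟩ := Submodule.mem_span_singleton.mp this
    exact ⟨k, hk.symm⟩
  obtain ⟨x, hx1, hx2⟩ := aux (φ := α.toLinear) (ψ := β.toLinear) (by
    rintro ⟨k, hk⟩
    exact h ⟨k, funext fun x ↦ LinearMap.congr_fun hk x⟩)
  obtain ⟨y, hy1, hy2⟩ := aux (φ := β.toLinear) (ψ := α.toLinear) (by
    rintro ⟨k, hk⟩
    have hk0 : k ≠ 0 := by
      rintro rfl
      exact hα (funext fun x ↦ by simpa using LinearMap.congr_fun hk x)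
    refine h ⟨k⁻¹, funext fun x ↦ ?_⟩
    have := LinearMap.congr_fun hk x
    simp only [Weight.toLinear_apply, LinearMap.smul_apply, smul_eq_mul] at this
    simp [this, hk0])
  intro a b
  refine ⟨a • y + b • x, ?_, ?_⟩
  · change (α : H →ₗ[K] K) (a • y + b • x) = a
    rw [map_add, map_smul, map_smul, hx1, hy2]; simp
  · change (β : H →ₗ[K] K) (a • y + b • x) = b
    rw [map_add, map_smul, map_smul, hx2, hy1]; simp

/-- If `β (coroot α) > 0`, then the bracket of the root spaces of `β` and `α - β` is nonzero. -/
lemma exists_lie_ne_zero_of_apply_coroot_pos {α β : Weight K H L} (hα : α.IsNonZero)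
    {n : ℕ} (hn : 0 < n) (hβ : β (coroot α) = n) :
    ∃ u ∈ rootSpace H β, ∃ v ∈ rootSpace H (α - β), ⁅u, v⁆ ≠ 0 := by
  obtain ⟨h, e, f, ht, he, hf⟩ := exists_isSl2Triple_of_weight_isNonZero hα
  obtain ⟨u, hu, hu0⟩ := β.exists_ne_zero
  have hh := ht.h_eq_coroot hα he hf
  have hfu : ⁅f, u⁆ ≠ 0 := by
    -- Otherwise `u` is primitive for the reversed triple `(-h, f, e)` with negative weight `-n`,
    -- impossible in finite dimension.
    intro h0
    have P : ht.symm.HasPrimitiveVectorWith u (-n : K) :=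
      { ne_zero := hu0
        lie_h := by
          have := lie_eq_smul_of_mem_rootSpace hu (coroot α)
          rw [neg_lie, hh, neg_smul, ← hβ]
          exact congrArg _ this
        lie_e := h0 }
    obtain ⟨m, hm⟩ := P.exists_nat
    have : ((n + m : ℕ) : K) = 0 := by push_cast; rw [← hm]; ring
    have := Nat.cast_eq_zero.mp this
    omega
  have hfu' : ⁅f, u⁆ ∈ rootSpace H (-α + β) := lie_mem_genWeightSpace_of_mem_genWeightSpace hf hu
  obtain ⟨w, hw, hκ⟩ : ∃ w ∈ rootSpace H (α - β), killingForm K L ⁅f, u⁆ w ≠ 0 := by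
    by_contra! hcon
    refine hfu ?_
    have := mem_ker_killingForm_of_mem_rootSpace_of_forall_rootSpace_neg K L H hfu' (fun y hy ↦ by
      refine hcon y ?_
      rwa [neg_add, neg_neg, ← sub_eq_add_neg] at hy)
    rw [ker_killingForm_eq_bot] at this
    simpa using this
  refine ⟨u, hu, w, hw, fun h0 ↦ hκ ?_⟩
  rw [killingForm_lie_left, h0, map_zero]

lemma lie_coe_of_mem_rootSpace {α : H → K} {x : L} (hx : x ∈ rootSpace H α) (h : H) :
    ⁅(h : L), x⁆ = α h • x :=
  lie_eq_smul_of_mem_rootSpace hx h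

lemma exists_eq_smul_of_mem_rootSpace {α : Weight K H L} (hα : α.IsNonZero) {x y : L}
    (hx : x ∈ rootSpace H α) (hx0 : x ≠ 0) (hy : y ∈ rootSpace H α) : ∃ c : K, y = c • x := by
  have hx0' : (⟨x, hx⟩ : rootSpace H α) ≠ 0 := fun h ↦ hx0 (congrArg Subtype.val h)
  obtain ⟨c, hc⟩ := exists_smul_eq_of_finrank_eq_one (finrank_rootSpace_eq_one α hα) hx0' ⟨y, hy⟩
  exact ⟨c, (congrArg Subtype.val hc).symm⟩

/-- The identity satisfied by `(x, y) ↦ ⁅J x, J' y⁆` where `J' ⁅x, y⁆ = ⁅J x, J y⁆`. -/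
def IsCyclic {L M : Type*} [LieRing L] [LieAlgebra K L] [AddCommGroup M] [Module K M]
    (T : L →ₗ[K] L →ₗ[K] M) : Prop :=
  ∀ x y z : L, T x ⁅y, z⁆ + T y ⁅z, x⁆ + T z ⁅x, y⁆ = 0

/-- The element of the Cartan subalgebra representing a weight through the Killing form. -/
noncomputable def rootDual (α : Weight K H L) : H :=
  (cartanEquivDual H).symm (α : H →ₗ[K] K)

lemma lie_eq_killingForm_smul_rootDual {α : Weight K H L} {u v : L} (hu : u ∈ rootSpace H α)
    (hv : v ∈ rootSpace H (-α)) : ⁅u, v⁆ = killingForm K L u v • (rootDual α : L) :=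
  lie_eq_killingForm_smul_of_mem_rootSpace_of_mem_rootSpace_neg hu hv

lemma span_rootDual_eq_top :
    Submodule.span K (rootDual '' {α : Weight K H L | α.IsNonZero}) = ⊤ := by
  have := span_weight_isNonZero_eq_top K L H
  have h2 := congrArg (Submodule.map (cartanEquivDual H).symm.toLinearMap) this
  rw [Submodule.map_span, Submodule.map_top, LinearEquiv.range, ← Set.image_comp] at h2
  exact h2

namespace IsCyclic

variable [AddCommGroup M] [Module K M] {T : L →ₗ[K] L →ₗ[K] M}

/-- The cyclic identity at `(x, h, h')`, where `⁅h, h'⁆ = 0`. For nonzero `α` it makes `h ↦ T h x`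
proportional to `α`. -/
lemma smul_apply_cartan (hc : IsCyclic T) {α : H → K} {x : L} (hx : x ∈ rootSpace H α)
    (h h' : H) : α h' • T h x = α h • T h' x := by
  have := hc x h h'
  have h0 : ⁅(h : L), (h' : L)⁆ = 0 := by
    have := congrArg (Subtype.val) (LieModule.IsTrivial.trivial h h')
    simpa using this
  rw [h0, ← lie_skew x, lie_coe_of_mem_rootSpace hx, lie_coe_of_mem_rootSpace hx] at this
  simp only [map_zero, map_smul, map_neg] at this
  linear_combination (norm := module) this

lemma smul_apply_sub_smul_apply (hc : IsCyclic T) {α β : H → K} {x y : L}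
    (hx : x ∈ rootSpace H α) (hy : y ∈ rootSpace H β) (h : H) :
    β h • T x y - α h • T y x = T h ⁅x, y⁆ := by
  have := hc x y h
  rw [← lie_skew y, lie_coe_of_mem_rootSpace hx, lie_coe_of_mem_rootSpace hy] at this
  simp only [map_smul, map_neg] at this
  linear_combination (norm := module) -this

lemma apply_eq_cartan_apply_lie (hc : IsCyclic T) {α β : H → K} {x y : L}
    (hx : x ∈ rootSpace H α) (hy : y ∈ rootSpace H β) {h : H} (hα : α h = 0) (hβ : β h = 1) :
    T x y = T h ⁅x, y⁆ := by
  have := hc.smul_apply_sub_smul_apply hx hy h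
  rw [hα, hβ] at this
  simpa using this

/-- Taking `α h = -1`, `β h = 1` gives the symmetric sum as `T h ⁅x, y⁆`. This is zero because the
weight `α + β` of `⁅x, y⁆` vanishes at `h` but not identically. -/
lemma add_flip_eq_zero_of_jointlySurjective (hc : IsCyclic T) {α β : H → K}
    (hαβ : JointlySurjective α β) {x y : L} (hx : x ∈ rootSpace H α) (hy : y ∈ rootSpace H β) :
    T x y + T y x = 0 := by
  obtain ⟨h, h1, h2⟩ := hαβ (-1) 1
  obtain ⟨h', h1', h2'⟩ := hαβ 0 1
  have e1 := hc.smul_apply_sub_smul_apply hx hy h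
  have e2 := hc.smul_apply_cartan (lie_mem_genWeightSpace_of_mem_genWeightSpace hx hy) h h'
  simp only [Pi.add_apply, h1, h2, h1', h2'] at e1 e2
  have e3 : T h ⁅x, y⁆ = 0 := by simpa using e2
  rw [e3] at e1
  linear_combination (norm := module) e1

/-- The form vanishes on the root space of a root `α` that splits as a sum of two other roots. -/
lemma apply_rootSpace_self (hc : IsCyclic T) {α : Weight K H L} (hα : α.IsNonZero)
    {β : H → K} (hαβ : JointlySurjective α β) {u v : L} (hu : u ∈ rootSpace H β)
    (hv : v ∈ rootSpace H (α - β)) (huv : ⁅u, v⁆ ≠ 0) {x y : L}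
    (hx : x ∈ rootSpace H α) (hy : y ∈ rootSpace H α) : T x y = 0 := by
  have mem {γ δ : H → K} {a b : L} (ha : a ∈ rootSpace H γ) (hb : b ∈ rootSpace H δ) :
      ⁅a, b⁆ ∈ rootSpace H (γ + δ) := lie_mem_genWeightSpace_of_mem_genWeightSpace ha hb
  have huv' : ⁅u, v⁆ ∈ rootSpace H α := by simpa using mem hu hv
  obtain ⟨c, rfl⟩ := exists_eq_smul_of_mem_rootSpace hα huv' huv hy
  have two {z : L} {γ : H → K} (hz : z ∈ rootSpace H γ) (hγ : γ = 2 • (α : H → K)) : z = 0 := by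
    subst hγ
    rw [rootSpace_two_smul α hα] at hz
    simpa using hz
  -- The values of `h` make the first weight 0 and the second 1, reducing to `T h` of a bracket of
  -- weight `2α`, which is not a root.
  have e1 : T u ⁅v, x⁆ = 0 := by
    obtain ⟨h, h1, h2⟩ := hαβ (1 / 2) 0
    rw [hc.apply_eq_cartan_apply_lie hu (mem hv hx) h2 (by simp [h1, h2]; norm_num),
      two (mem hu (mem hv hx)) (by abel), map_zero]
  have e2 : T v ⁅x, u⁆ = 0 := by
    obtain ⟨h, h1, h2⟩ := hαβ (1 / 2) (1 / 2)
    rw [hc.apply_eq_cartan_apply_lie (h := h) hv (mem hx hu) (by simp [h1, h2])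
      (by simp [h1, h2]; norm_num),
      two (mem hv (mem hx hu)) (by abel), map_zero]
  have := hc x u v
  rw [e1, e2, add_zero, add_zero] at this
  rw [map_smul, this, smul_zero]

/-- With `rootDual β` written as `⁅u, v⁆` and `k` chosen so that `α k = 1`, `β k = 0`, the other two
cyclic terms both become values of `T k`, and Jacobi combines them into `T k (α (rootDual β) • x)`.
-/
lemma add_flip_cartan_of_jointlySurjective (hc : IsCyclic T) {α : H → K} {β : Weight K H L}
    (hαβ : JointlySurjective α β) {x : L} (hx : x ∈ rootSpace H α) :
    T x (rootDual β : H) + T (rootDual β : H) x = 0 := by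
  have mem {γ δ : H → K} {a b : L} (ha : a ∈ rootSpace H γ) (hb : b ∈ rootSpace H δ) :
      ⁅a, b⁆ ∈ rootSpace H (γ + δ) := lie_mem_genWeightSpace_of_mem_genWeightSpace ha hb
  obtain ⟨u, hu, v, hv, huv⟩ : ∃ u ∈ rootSpace H β, ∃ v ∈ rootSpace H (-β),
      ⁅u, v⁆ = (rootDual β : H) := by
    obtain ⟨u, hu, v, hv, -, -, h⟩ := exists_killingForm_eq_one β
    exact ⟨u, hu, v, hv, by rw [lie_eq_killingForm_smul_rootDual hu hv, h, one_smul]⟩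
  obtain ⟨k, h1, h2⟩ := hαβ 1 0
  have e := hc x u v
  have h3 := hc.smul_apply_cartan hx k (rootDual β)
  rw [hc.apply_eq_cartan_apply_lie hu (mem hv hx) h2 (by simp [h1, h2]),
    hc.apply_eq_cartan_apply_lie (h := k) hv (mem hx hu) (by simp [h2]) (by simp [h1, h2]), add_assoc,
    ← map_add] at e
  have jac : ⁅u, ⁅v, x⁆⁆ + ⁅v, ⁅x, u⁆⁆ = α (rootDual β) • x := by
    have := lie_jacobi u v x
    rw [← lie_coe_of_mem_rootSpace hx, ← huv, ← lie_skew ⁅u, v⁆ x, eq_neg_iff_add_eq_zero, this]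
  rw [jac, huv, map_smul, h3, h1, one_smul] at e
  exact e

end IsCyclic

end Roots

/-! ### Root splittings and skewness in rank at least two -/

section RootSplitting

open LieAlgebra LieModule LieAlgebra.IsKilling

variable {K L M : Type*} [Field K] [CharZero K] [LieRing L] [LieAlgebra K L]
  [FiniteDimensional K L]
  {H : LieSubalgebra K L} [H.IsCartanSubalgebra] [IsTriangularizable K H L]

/-- In rank at least two, every root of a simple Lie algebra makes an acute angle with some
independent root. -/
lemma exists_jointlySurjective_apply_coroot_pos [IsSimple K L] (hH : 2 ≤ Module.finrank K H)
    {α : Weight K H L} (hα : α.IsNonZero) :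
    ∃ β : Weight K H L, β.IsNonZero ∧ JointlySurjective (H := H) α β ∧
      ∃ n : ℕ, 0 < n ∧ β (coroot α) = n := by
  let P := rootSystem H
  let i : H.root := ⟨α, by simpa [LieSubalgebra.root] using hα⟩
  obtain ⟨j, hj, hij⟩ : ∃ j, P.root j ∉ Submodule.span K (P.root '' {i}) ∧
      ¬ P.IsOrthogonal j i := by
    -- If every root off the line of `α` were orthogonal to `α`, irreducibility would make that line
    -- the whole dual of `H`.
    by_contra! hcon
    have := RootPairing.span_root_image_eq_top_of_forall_orthogonal P {i} (by simp)
      (fun j hj k hk ↦ by rw [Set.mem_singleton_iff.mp hk]; exact hcon j hj)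
    rw [Set.image_singleton] at this
    have h1 := finrank_span_singleton (K := K) (P.ne_zero i)
    rw [this, finrank_top, Subspace.dual_finrank_eq] at h1
    omega
  let β : Weight K H L := j
  have hβ : β.IsNonZero := H.isNonZero_coe_root j
  have hαβ : JointlySurjective (H := H) α β := by
    rw [Set.image_singleton] at hj
    rcases eq_or_eq_neg_or_jointlySurjective hα hβ with h | h | h
    · refine absurd ?_ hj
      have : P.root j = - P.root i := congrArg (Weight.toLinear K H L) h
      rw [this]
      exact Submodule.neg_mem _ (Submodule.mem_span_singleton_self _)
    · refine absurd ?_ hj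
      have : P.root j = P.root i := congrArg (Weight.toLinear K H L) h
      rw [this]
      exact Submodule.mem_span_singleton_self _
    · exact h
  have hne : β (coroot α) ≠ 0 := fun h ↦ hij (by
    rw [RootPairing.IsOrthogonal]
    have h1 : P.pairing j i = 0 := h
    exact ⟨h1, (P.pairing_eq_zero_iff).mp h1⟩)
  have hcast := apply_coroot_eq_cast α β
  generalize (chainBotCoeff (α : H → K) β - chainTopCoeff (α : H → K) β : ℤ) = m at hcast
  rcases lt_trichotomy m 0 with hm | rfl | hm
  · refine ⟨-β, hβ.neg, fun a b ↦ ?_, m.natAbs, by omega, ?_⟩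
    · obtain ⟨h, h1, h2⟩ := hαβ a (-b)
      exact ⟨h, h1, by simp [h2]⟩
    · obtain ⟨n, rfl⟩ := Int.exists_eq_neg_ofNat hm.le
      simp [hcast]
  · exact absurd (by simpa using hcast) hne
  · refine ⟨β, hβ, hαβ, m.natAbs, by omega, ?_⟩
    obtain ⟨n, rfl⟩ := Int.eq_ofNat_of_zero_le hm.le
    simp [hcast]

/-- In rank at least two, every root space of a simple Lie algebra is the bracket of two other root
spaces, and the same two roots serve for the negative root. -/
lemma exists_root_splitting [IsSimple K L] (hH : 2 ≤ Module.finrank K H)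
    {α : Weight K H L} (hα : α.IsNonZero) :
    ∃ β δ : Weight K H L, β.IsNonZero ∧ δ.IsNonZero ∧ (δ : H → K) = α - β ∧
      JointlySurjective (H := H) α β ∧
      (∃ u ∈ rootSpace H β, ∃ v ∈ rootSpace H δ, ⁅u, v⁆ ≠ 0) ∧
      (∃ u ∈ rootSpace H (-β), ∃ v ∈ rootSpace H (-δ), ⁅u, v⁆ ≠ 0) := by
  obtain ⟨β, hβ, hαβ, n, hn, hpair⟩ := exists_jointlySurjective_apply_coroot_pos hH hα
  obtain ⟨u, hu, v, hv, huv⟩ := exists_lie_ne_zero_of_apply_coroot_pos hα hn hpair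
  obtain ⟨u', hu', v', hv', huv'⟩ := exists_lie_ne_zero_of_apply_coroot_pos (α := -α) (β := -β)
    hα.neg hn (by simpa using hpair)
  have hδ : genWeightSpace L ((α : H → K) - (β : H → K)) ≠ ⊥ := fun h ↦ by
    have hv0 : v = 0 := by
      rw [rootSpace, h] at hv
      simpa using hv
    exact huv (by rw [hv0, lie_zero])
  refine ⟨β, ⟨_, hδ⟩, hβ, fun h0 ↦ ?_, rfl, hαβ, ⟨u, hu, v, hv, huv⟩, u', hu', v', ?_, huv'⟩
  · obtain ⟨h, h1, h2⟩ := hαβ 1 0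
    have := congrFun (show (α : H → K) - (β : H → K) = 0 from h0) h
    simp [h1, h2] at this
  · convert hv' using 2
    simp [neg_add_eq_sub]

/-- Root spaces are lines paired nontrivially by the Killing form, so `T` is determined there by a
single vector. -/
lemma exists_apply_eq_killingForm_smul [IsKilling K L] [AddCommGroup M] [Module K M]
    (T : L →ₗ[K] L →ₗ[K] M)
    {α : Weight K H L} (hα : α.IsNonZero) :
    ∃ a : M, ∀ x ∈ rootSpace H α, ∀ y ∈ rootSpace H (-α), T x y = killingForm K L x y • a := by
  obtain ⟨u, hu, v, hv, hu0, hv0, huv⟩ := exists_killingForm_eq_one α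
  refine ⟨T u v, fun x hx y hy ↦ ?_⟩
  obtain ⟨c, rfl⟩ := exists_eq_smul_of_mem_rootSpace hα hu hu0 hx
  obtain ⟨d, rfl⟩ := exists_eq_smul_of_mem_rootSpace (α := -α) hα.neg hv hv0 hy
  simp only [map_smul, LinearMap.smul_apply, huv, smul_eq_mul]
  module

namespace IsCyclic

variable [IsKilling K L] [AddCommGroup M] [Module K M] {T : L →ₗ[K] L →ₗ[K] M}

lemma cartan_apply_rootDual (hc : IsCyclic T) {α : Weight K H L} {a b : M}
    (ha : ∀ x ∈ rootSpace H α, ∀ y ∈ rootSpace H (-α), T x y = killingForm K L x y • a)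
    (hb : ∀ x ∈ rootSpace H (-α), ∀ y ∈ rootSpace H α, T x y = killingForm K L x y • b) (h : H) :
    T h (rootDual α : H) = -(α h • (a + b)) := by
  obtain ⟨u, hu, v, hv, -, -, huv⟩ := exists_killingForm_eq_one α
  have := hc.smul_apply_sub_smul_apply hu hv h
  rw [lie_eq_killingForm_smul_rootDual hu hv, huv, one_smul, ha u hu v hv, hb v hv u hu,
    killingForm_comm v u, huv] at this
  rw [← this, Pi.neg_apply]
  module

/-- In the cyclic identity on root vectors of weights `β`, `δ`, `-α`, invariance gives all three
terms the same nonzero Killing coefficient. -/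
lemma add_add_eq_zero_of_lie_ne_zero (hc : IsCyclic T) {α β δ : Weight K H L} (hα : α.IsNonZero)
    (hδ : (δ : H → K) = α - β) {u v : L} (hu : u ∈ rootSpace H β) (hv : v ∈ rootSpace H δ)
    (huv : ⁅u, v⁆ ≠ 0) {a b d : M}
    (ha : ∀ x ∈ rootSpace H (-α), ∀ y ∈ rootSpace H α, T x y = killingForm K L x y • a)
    (hb : ∀ x ∈ rootSpace H β, ∀ y ∈ rootSpace H (-β), T x y = killingForm K L x y • b)
    (hd : ∀ x ∈ rootSpace H δ, ∀ y ∈ rootSpace H (-δ), T x y = killingForm K L x y • d) :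
    a + b + d = 0 := by
  have mem {γ δ ε : H → K} {a b : L} (ha : a ∈ rootSpace H γ) (hb : b ∈ rootSpace H δ)
      (h : ε = γ + δ) : ⁅a, b⁆ ∈ rootSpace H ε :=
    h ▸ lie_mem_genWeightSpace_of_mem_genWeightSpace ha hb
  obtain ⟨e, he, w, hw, he0, -, hew⟩ := exists_killingForm_eq_one α
  obtain ⟨c, hc'⟩ := exists_eq_smul_of_mem_rootSpace hα he he0 (mem hu hv (by rw [hδ]; abel))
  have hc0 : c ≠ 0 := by
    rintro rfl
    exact huv (by simpa using hc')
  have hN : killingForm K L ⁅u, v⁆ w = c := by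
    rw [hc', map_smul, LinearMap.smul_apply, hew, smul_eq_mul, mul_one]
  have := hc u v w
  rw [hb u hu _ (mem hv hw (by rw [hδ]; abel)), hd v hv _ (mem hw hu (by rw [hδ]; abel)),
    ha w hw _ (mem hu hv (by rw [hδ]; abel)), ← killingForm_lie_left u, ← killingForm_lie_left v,
    killingForm_comm _ u, ← killingForm_lie_left u, killingForm_comm w, hN, ← smul_add,
    ← smul_add] at this
  rw [add_assoc, add_comm a]
  exact (smul_eq_zero.mp this).resolve_left hc0

end IsCyclic

namespace IsCyclic

variable [IsSimple K L] [AddCommGroup M] [Module K M] {T : L →ₗ[K] L →ₗ[K] M}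

/-- The vectors `rootDual γ` span `H`. Those with `γ` independent of `α` are already covered; `γ =
±α` follows from `rootDual α = rootDual β + rootDual δ`. -/
lemma add_flip_cartan (hc : IsCyclic T) (hH : 2 ≤ Module.finrank K H) {α : Weight K H L}
    (hα : α.IsNonZero) {x : L} (hx : x ∈ rootSpace H α) (h : H) : T x h + T h x = 0 := by
  have hh : h ∈ Submodule.span K (rootDual '' {α : Weight K H L | α.IsNonZero}) := by
    rw [span_rootDual_eq_top]; trivial
  have self : T x (rootDual α : H) + T (rootDual α : H) x = 0 := by
    obtain ⟨β, δ, hβ, -, hδ, hαβ, -⟩ := exists_root_splitting hH hα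
    have hsum : rootDual α = rootDual β + rootDual δ := by
      rw [rootDual, rootDual, rootDual, ← map_add]
      congr 1
      ext h
      simp [hδ]
    have e1 := hc.add_flip_cartan_of_jointlySurjective hαβ hx
    have e2 := hc.add_flip_cartan_of_jointlySurjective (α := α) (β := δ) (fun a b ↦ by
      obtain ⟨h, h1, h2⟩ := hαβ a (a - b)
      exact ⟨h, h1, by simp [hδ, h1, h2]⟩) hx
    rw [hsum, Submodule.coe_add, map_add, map_add, LinearMap.add_apply]
    linear_combination (norm := module) e1 + e2
  induction hh using Submodule.span_induction with
  | mem h hh =>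
    obtain ⟨γ, hγ, rfl⟩ := hh
    rcases eq_or_eq_neg_or_jointlySurjective hα hγ with rfl | rfl | hαγ
    · have hneg : rootDual (-α) = -rootDual α := by
        rw [rootDual, rootDual, ← map_neg]
        rfl
      rw [hneg, Submodule.coe_neg, map_neg, map_neg, LinearMap.neg_apply, ← neg_add, self, neg_zero]
    · exact self
    · exact hc.add_flip_cartan_of_jointlySurjective hαγ hx
  | zero => simp
  | add h h' _ _ ih ih' =>
    rw [Submodule.coe_add, map_add, map_add, LinearMap.add_apply]
    linear_combination (norm := module) ih + ih'
  | smul c h _ ih =>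
    rw [Submodule.coe_smul, map_smul, map_smul, LinearMap.smul_apply, ← smul_add, ih, smul_zero]

/-- Let `s γ` be the sum of the coefficients at `γ` and `-γ`. Triples of root vectors give `s α + s
β + s δ = 0`, and additivity of `rootDual` gives `α h • s α = β h • s β + δ h • s δ`. Independence
of `α` and `β` then yields `s α = s β = s δ`, so `3 • s α = 0`. -/
lemma add_eq_zero_of_apply_eq_killingForm_smul (hc : IsCyclic T) (hH : 2 ≤ Module.finrank K H)
    {α : Weight K H L} (hα : α.IsNonZero) {a a' : M}
    (ha : ∀ x ∈ rootSpace H α, ∀ y ∈ rootSpace H (-α), T x y = killingForm K L x y • a)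
    (ha' : ∀ x ∈ rootSpace H (-α), ∀ y ∈ rootSpace H α, T x y = killingForm K L x y • a') :
    a + a' = 0 := by
  obtain ⟨β, δ, hβ, hδ0, hδ, hαβ, ⟨u, hu, v, hv, huv⟩, u', hu', v', hv', huv'⟩ :=
    exists_root_splitting hH hα
  obtain ⟨b, hb⟩ := exists_apply_eq_killingForm_smul T hβ
  obtain ⟨b', hb'⟩ := exists_apply_eq_killingForm_smul T hβ.neg
  obtain ⟨d, hd⟩ := exists_apply_eq_killingForm_smul T hδ0
  obtain ⟨d', hd'⟩ := exists_apply_eq_killingForm_smul T hδ0.neg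
  have e1 := hc.add_add_eq_zero_of_lie_ne_zero hα hδ hu hv huv ha' hb hd
  have e2 := hc.add_add_eq_zero_of_lie_ne_zero (α := -α) (β := -β) (δ := -δ) hα.neg
    (by simp [hδ, neg_add_eq_sub]) hu' hv' huv' (by simpa using ha) hb' hd'
  have hsum : rootDual α = rootDual β + rootDual δ := by
    rw [rootDual, rootDual, rootDual, ← map_add]
    congr 1
    ext h
    simp [hδ]
  have key (h : H) : α h • (a + a') = β h • (b + b') + δ h • (d + d') := by
    have h1 := hc.cartan_apply_rootDual ha ha' h
    rw [hsum, Submodule.coe_add, map_add, hc.cartan_apply_rootDual hb (by simpa using hb') h,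
      hc.cartan_apply_rootDual hd (by simpa using hd') h] at h1
    linear_combination (norm := module) h1
  obtain ⟨h, h1, h2⟩ := hαβ 1 1
  obtain ⟨k, k1, k2⟩ := hαβ 1 0
  have f1 := key h
  have f2 := key k
  simp only [hδ, Pi.sub_apply, h1, h2, k1, k2, sub_self, zero_smul, one_smul, add_zero, sub_zero,
    zero_add] at f1 f2
  have h3 : (3 : K) • (a + a') = 0 := by
    linear_combination (norm := module) e1 + e2 + f1 + f2
  exact (smul_eq_zero.mp h3).resolve_left (by norm_num)

/-- On a simple Lie algebra of rank at least two, cyclic bilinear maps are skew-symmetric. -/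
theorem skew (hc : IsCyclic T) (H : LieSubalgebra K L) [H.IsCartanSubalgebra]
    [IsTriangularizable K H L] (hH : 2 ≤ Module.finrank K H) (x y : L) : T x y = - T y x := by
  rw [eq_neg_iff_add_eq_zero]
  have main (χ ψ : Weight K H L) (x : L) (hx : x ∈ rootSpace H χ) (y : L)
      (hy : y ∈ rootSpace H ψ) : T x y + T y x = 0 := by
    by_cases hχ : χ.IsZero <;> by_cases hψ : ψ.IsZero
    · have hHH (h h' : H) : T h h' = 0 := by
        have hh : h' ∈ Submodule.span K (rootDual '' {α : Weight K H L | α.IsNonZero}) := by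
          rw [span_rootDual_eq_top]; trivial
        induction hh using Submodule.span_induction with
        | mem k hk =>
          obtain ⟨α, hα, rfl⟩ := hk
          obtain ⟨a, ha⟩ := exists_apply_eq_killingForm_smul T hα
          obtain ⟨b, hb⟩ := exists_apply_eq_killingForm_smul T (α := -α) (Weight.IsNonZero.neg hα)
          rw [hc.cartan_apply_rootDual ha (by simpa using hb),
            hc.add_eq_zero_of_apply_eq_killingForm_smul hH hα ha (by simpa using hb), smul_zero,
            neg_zero]
        | zero => simp
        | add k k' _ _ ih ih' => rw [Submodule.coe_add, map_add, ih, ih', add_zero]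
        | smul c k _ ih => rw [Submodule.coe_smul, map_smul, ih, smul_zero]
      rw [hχ.eq, rootSpace_zero_eq] at hx
      rw [hψ.eq, rootSpace_zero_eq] at hy
      rw [hHH ⟨x, hx⟩ ⟨y, hy⟩, hHH ⟨y, hy⟩ ⟨x, hx⟩, add_zero]
    · rw [hχ.eq, rootSpace_zero_eq] at hx
      rw [add_comm]
      exact hc.add_flip_cartan hH hψ hy ⟨x, hx⟩
    · rw [hψ.eq, rootSpace_zero_eq] at hy
      exact hc.add_flip_cartan hH hχ hx ⟨y, hy⟩
    · rcases eq_or_eq_neg_or_jointlySurjective hχ hψ with rfl | rfl | h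
      · obtain ⟨a, ha⟩ := exists_apply_eq_killingForm_smul T hχ
        obtain ⟨b, hb⟩ := exists_apply_eq_killingForm_smul T hψ
        have hab := hc.add_eq_zero_of_apply_eq_killingForm_smul hH hχ ha (by simpa using hb)
        rw [ha x hx y hy, hb y hy x (by simpa using hx), killingForm_comm y x, ← smul_add, hab,
          smul_zero]
      · obtain ⟨β, δ, -, -, hδ, hαβ, ⟨u, hu, v, hv, huv⟩, -⟩ := exists_root_splitting hH hχ
        rw [hδ] at hv
        rw [hc.apply_rootSpace_self hχ hαβ hu hv huv hx hy,
          hc.apply_rootSpace_self hχ hαβ hu hv huv hy hx, add_zero]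
      · exact hc.add_flip_eq_zero_of_jointlySurjective h hx hy
  have top : ⨆ χ : Weight K H L, (rootSpace H χ).toSubmodule = ⊤ := by
    rw [← LieSubmodule.iSup_toSubmodule, iSup_genWeightSpace_eq_top', LieSubmodule.top_toSubmodule]
  have hx : x ∈ ⨆ χ : Weight K H L, (rootSpace H χ).toSubmodule := top ▸ Submodule.mem_top
  have hy : y ∈ ⨆ χ : Weight K H L, (rootSpace H χ).toSubmodule := top ▸ Submodule.mem_top
  induction hx using Submodule.iSup_induction' with
  | zero => simp
  | add a b _ _ iha ihb =>
    rw [map_add, map_add, LinearMap.add_apply]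
    linear_combination (norm := module) iha + ihb
  | mem χ x hx =>
    induction hy using Submodule.iSup_induction' with
    | zero => simp
    | add a b _ _ iha ihb =>
      rw [map_add, map_add, LinearMap.add_apply]
      linear_combination (norm := module) iha + ihb
    | mem ψ y hy => exact main χ ψ x hx y hy

end IsCyclic

end RootSplitting

/-! ### Cartan subalgebras and the rank -/

section Rank

open LieAlgebra LieModule LieAlgebra.IsKilling

variable {K L : Type*} [Field K] [LieRing L] [LieAlgebra K L] [FiniteDimensional K L]

variable (K L) in
/-- Over an infinite field there is a Cartan subalgebra whose dimension is the rank. -/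
lemma exists_isCartanSubalgebra_finrank_eq_rank [Infinite K] :
    ∃ H : LieSubalgebra K L, H.IsCartanSubalgebra ∧ Module.finrank K H = LieAlgebra.rank K L := by
  have hcard : (Module.finrank K L : Cardinal) ≤ Cardinal.mk K :=
    Cardinal.natCast_le_aleph0.trans (Cardinal.infinite_iff.mp ‹Infinite K›)
  obtain ⟨x, hx⟩ := LieAlgebra.exists_isRegular_of_finrank_le_card K L hcard
  have hrank := (LieAlgebra.isRegular_iff_finrank_engel_eq_rank K x).mp hx
  refine ⟨LieSubalgebra.engel K x, ⟨?_, LieSubalgebra.normalizer_engel _ _⟩, hrank⟩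
  apply LieSubalgebra.isNilpotent_of_forall_le_engel
  intro y hy
  let E : {LieSubalgebra.engel K z | z ∈ LieSubalgebra.engel K x} :=
    ⟨LieSubalgebra.engel K x, x, LieSubalgebra.self_mem_engel _ _, rfl⟩
  suffices IsBot E from @this ⟨LieSubalgebra.engel K y, y, hy, rfl⟩
  -- Minimality is a dimension count: no Engel subalgebra has dimension below the rank, which `engel
  -- K x` attains.
  apply engel_isBot_of_isMin hcard (LieSubalgebra.engel K x) E le_rfl
  rintro ⟨_, y, hy, rfl⟩ hyx
  have hle : Module.finrank K (LieSubalgebra.engel K x) ≤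
      Module.finrank K (LieSubalgebra.engel K y) := hrank ▸ LieAlgebra.rank_le_finrank_engel K y
  have : LieSubalgebra.engel K y = LieSubalgebra.engel K x :=
    LieSubalgebra.toSubmodule_injective (Submodule.eq_of_le_of_finrank_le hyx hle)
  exact this.ge

/-- A simple Lie algebra whose Cartan subalgebra is one-dimensional is spanned by an
`sl₂`-triple. -/
lemma exists_isSl2Triple_span_of_finrank_eq_one [CharZero K] [IsSimple K L]
    {H : LieSubalgebra K L} [H.IsCartanSubalgebra] [IsTriangularizable K H L]
    (hH : Module.finrank K H = 1) :
    ∃ h e f : L, IsSl2Triple h e f ∧ ∀ x, ∃ a b c : K, x = a • e + b • f + c • h := by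
  obtain ⟨α, hα⟩ : ∃ α : Weight K H L, α.IsNonZero := by
    by_contra! hcon
    have h1 := span_rootDual_eq_top (K := K) (L := L) (H := H)
    have h2 : {α : Weight K H L | α.IsNonZero} = ∅ := Set.eq_empty_of_forall_notMem fun α hα ↦ hα (hcon α)
    rw [h2, Set.image_empty, Submodule.span_empty] at h1
    rw [← finrank_top, ← h1, finrank_bot] at hH
    exact zero_ne_one hH
  obtain ⟨h, e, f, ht, he, hf⟩ := exists_isSl2Triple_of_weight_isNonZero hα
  have hcor := ht.h_eq_coroot hα he hf
  refine ⟨h, e, f, ht, fun x ↦ ?_⟩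
  have hHh (y : H) : ∃ c : K, c • (coroot α : H) = y :=
    (finrank_eq_one_iff_of_nonzero' _ (by simpa using hα)).mp hH y
  have hspan : Submodule.span K {e, f, h} = ⊤ := by
    rw [eq_top_iff, ← LieSubmodule.top_toSubmodule (R := K) (L := H),
      ← iSup_genWeightSpace_eq_top' K H L, LieSubmodule.iSup_toSubmodule]
    refine iSup_le fun χ x hx ↦ ?_
    replace hx : x ∈ rootSpace H χ := hx
    by_cases hχ : χ.IsZero
    · rw [hχ.eq, rootSpace_zero_eq] at hx
      obtain ⟨c, hc⟩ := hHh ⟨x, hx⟩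
      have hc' : c • h = x := by rw [hcor]; exact congrArg Subtype.val hc
      rw [← hc']
      exact Submodule.smul_mem _ _ (Submodule.subset_span (by simp))
    · rcases eq_or_eq_neg_or_jointlySurjective hα hχ with rfl | rfl | hj
      · obtain ⟨c, rfl⟩ := exists_eq_smul_of_mem_rootSpace hχ hf ht.f_ne_zero hx
        exact Submodule.smul_mem _ _ (Submodule.subset_span (by simp))
      · obtain ⟨c, rfl⟩ := exists_eq_smul_of_mem_rootSpace hχ he ht.e_ne_zero hx
        exact Submodule.smul_mem _ _ (Submodule.subset_span (by simp))
      -- No root is independent of `α` on a line: `y = c • coroot α` and `α y = 2 * c = 0` force `y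
      -- = 0`.
      · obtain ⟨y, h1, h2⟩ := hj 0 1
        obtain ⟨c, rfl⟩ := hHh y
        have h1' : (α : H →ₗ[K] K) (c • coroot α) = 0 := h1
        have h2' : (χ : H →ₗ[K] K) (c • coroot α) = 1 := h2
        rw [map_smul, smul_eq_mul, Weight.toLinear_apply, root_apply_coroot hα] at h1'
        have hc : c = 0 := by simpa using h1'
        rw [hc, zero_smul, map_zero] at h2'
        exact absurd h2' zero_ne_one
  have hx : x ∈ Submodule.span K {e, f, h} := hspan ▸ Submodule.mem_top
  obtain ⟨a, b, c, h⟩ := Submodule.mem_span_triple.mp hx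
  exact ⟨a, b, c, h.symm⟩

end Rank

/-! ### The level-2 relation for `sl₂` -/

section RankOne

variable {g : Type u} [LieRing g] [LieAlgebra ℂ g]

/-- The level-2 relation is trivial when `g` is spanned by an `sl₂`-triple. -/
lemma level2Expr_eq_zero_of_isSl2Triple {h e f : g} (ht : IsSl2Triple h e f)
    (hspan : ∀ x, ∃ a b c : ℂ, x = a • e + b • f + c • h)
    {A : Type w} [LieRing A] [LieAlgebra ℂ A] (J : g →ₗ[ℂ] A) (p q r : g) :
    level2Expr J p q r = 0 := by
  have he : ⁅h, e⁆ = (2 : ℂ) • e := by rw [ht.lie_h_e_nsmul]; module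
  have hf : ⁅h, f⁆ = -((2 : ℂ) • f) := by rw [ht.lie_h_f_nsmul]; module
  have hlie (a b c a' b' c' : ℂ) :
      ⁅a • e + b • f + c • h, a' • e + b' • f + c' • h⁆ =
        (2 * (c * a' - a * c')) • e + (2 * (b * c' - c * b')) • f + (a * b' - b * a') • h := by
    simp only [lie_add, add_lie, lie_smul, smul_lie, lie_self, ht.lie_e_f, ← lie_skew e h,
      ← lie_skew f h, ← lie_skew f e, he, hf]
    module
  have hJ (a b c : ℂ) : J (a • e + b • f + c • h) = a • J e + b • J f + c • J h := by simp
  obtain ⟨a, b, c, rfl⟩ := hspan p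
  obtain ⟨a', b', c', rfl⟩ := hspan q
  obtain ⟨a'', b'', c'', rfl⟩ := hspan r
  rw [level2Expr, hlie, hlie, hlie, hJ, hJ, hJ, hJ, hJ, hJ]
  simp only [lie_add, add_lie, lie_smul, smul_lie, lie_self, ← lie_skew (J f) (J e),
    ← lie_skew (J h) (J e), ← lie_skew (J h) (J f)]
  module

end RankOne

/-! ### Construction of the higher levels -/

section Levels

variable {g : Type u} [LieRing g] [LieAlgebra ℂ g] {A : Type w} [LieRing A] [LieAlgebra ℂ A]

/-- The bilinear map `(p, q) ↦ ⁅F p, G q⁆`. -/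
def lieBilin (F G : g →ₗ[ℂ] A) : g →ₗ[ℂ] g →ₗ[ℂ] A :=
  (LieModule.toEnd ℂ A A : A →ₗ[ℂ] A →ₗ[ℂ] A).compl₁₂ F G

@[simp]
lemma lieBilin_apply (F G : g →ₗ[ℂ] A) (p q : g) : lieBilin F G p q = ⁅F p, G q⁆ := rfl

open Classical in
/-- The maps `y ↦ y⁽ⁿ⁾` into a Lie algebra `A`, built from those for `n = 0` and `n = 1` so that
`⁅p⁽¹⁾, q⁽ⁿ⁾⁆ = ⁅p, q⁆⁽ⁿ⁺¹⁾` whenever this is possible. -/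
noncomputable def levels (X J : g →ₗ[ℂ] A) : ℕ → g →ₗ[ℂ] A
  | 0 => X
  | 1 => J
  | n + 2 =>
    -- The value `0` is only a default; under the relations of levels 0 to 3 the factorization
    -- exists at every level.
    if h : ∃ G : g →ₗ[ℂ] A, ∀ p q : g, ⁅J p, levels X J (n + 1) q⁆ = G ⁅p, q⁆ then h.choose else 0

lemma lie_levels_succ {X J : g →ₗ[ℂ] A} {n : ℕ}
    (h : ∃ G : g →ₗ[ℂ] A, ∀ p q : g, ⁅J p, levels X J (n + 1) q⁆ = G ⁅p, q⁆) (p q : g) :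
    ⁅J p, levels X J (n + 1) q⁆ = levels X J (n + 2) ⁅p, q⁆ := by
  rw [levels, dif_pos h]
  exact h.choose_spec p q

variable [FiniteDimensional ℂ g] [LieAlgebra.IsSimple ℂ g]

lemma lie_J_J {X J : g →ₗ[ℂ] A} (h2 : ∀ p q r, level2Expr J p q r = 0) (p q : g) :
    ⁅J p, J q⁆ = levels X J 2 ⁅p, q⁆ :=
  lie_levels_succ (n := 0) (X := X) (exists_factor_lie_of_cocycle (lieBilin J J)
    (fun _ _ ↦ (lie_skew _ _).symm) h2) p q

/-- This is the Jacobi identity for `J p`, `J q`, `J r`. -/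
lemma isCyclic_lieBilin_levels_two {X J : g →ₗ[ℂ] A} (h2 : ∀ p q r, level2Expr J p q r = 0) :
    IsCyclic (lieBilin J (levels X J 2)) := fun p q r ↦ by
  simp only [lieBilin_apply, ← lie_J_J h2]
  exact lie_jacobi _ _ _

/-- Hence, `g` being perfect, the level-3 relation is equivalent to skewness of `lieBilin J (levels
X J 2)`. -/
lemma level3Expr_eq_neg {X J : g →ₗ[ℂ] A} (h2 : ∀ p q r, level2Expr J p q r = 0) (p q r s : g) :
    level3Expr J p q r s = -(lieBilin J (levels X J 2) ⁅r, s⁆ ⁅p, q⁆ +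
      lieBilin J (levels X J 2) ⁅p, q⁆ ⁅r, s⁆) := by
  rw [level3Expr, lie_J_J (X := X) h2, lie_J_J (X := X) h2, lieBilin_apply, lieBilin_apply,
    neg_add, lie_skew, lie_skew]

/-- Degree 2 uses level 2, degree 3 uses level 3 to supply skewness, and from degree 4 on Jacobi
with the lower degrees gives a graded cocycle. -/
lemma exists_lie_levels_eq {X J : g →ₗ[ℂ] A} (h2 : ∀ p q r, level2Expr J p q r = 0)
    (h3 : ∀ p q r s, level3Expr J p q r s = 0) {N : ℕ} (hN : 2 ≤ N)
    (ih : ∀ i j, i + j < N → ∀ p q : g,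
      ⁅levels X J i p, levels X J j q⁆ = levels X J (i + j) ⁅p, q⁆) :
    ∃ G : g →ₗ[ℂ] A, ∀ i j, 1 ≤ i → 1 ≤ j → i + j = N → ∀ p q : g,
      ⁅levels X J i p, levels X J j q⁆ = G ⁅p, q⁆ := by
  obtain rfl | rfl | hN : N = 2 ∨ N = 3 ∨ 4 ≤ N := by omega
  · refine ⟨levels X J 2, fun i j hi hj hij p q ↦ ?_⟩
    obtain ⟨rfl, rfl⟩ : i = 1 ∧ j = 1 := by omega
    exact lie_J_J h2 p q
  · have hskew (x y : g) : lieBilin J (levels X J 2) x y = - lieBilin J (levels X J 2) y x := by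
      rw [eq_neg_iff_add_eq_zero]
      suffices h : lieBilin J (levels X J 2) + (lieBilin J (levels X J 2)).flip = 0 from
        LinearMap.congr_fun₂ h x y
      refine linearMap_ext_lie fun p q ↦ linearMap_ext_lie fun r s ↦ ?_
      have := level3Expr_eq_neg (X := X) h2 r s p q
      rw [h3, zero_eq_neg] at this
      exact this
    obtain ⟨G, hG⟩ := exists_factor_lie_of_cocycle _ hskew (isCyclic_lieBilin_levels_two h2)
    refine ⟨G, fun i j hi hj hij p q ↦ ?_⟩
    obtain ⟨rfl, rfl⟩ | ⟨rfl, rfl⟩ : i = 1 ∧ j = 2 ∨ i = 2 ∧ j = 1 := by omega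
    · exact hG p q
    · rw [← lie_skew, ← lie_skew p, map_neg]
      exact congrArg _ (hG q p)
  · obtain ⟨G, hG⟩ := exists_factor_lie_of_graded_cocycle hN
      (fun i ↦ lieBilin (levels X J i) (levels X J (N - i)))
      (fun i j hi hj hij p q ↦ by
        obtain rfl : j = N - i := by omega
        rw [lieBilin_apply, lieBilin_apply, lie_skew, Nat.sub_sub_self (by omega)])
      (fun i j k hi hj hk hN p q r ↦ by
        simp only [lieBilin_apply]
        rw [show N - i = j + k by omega, show N - j = k + i by omega,
          show N - k = i + j by omega, ← ih j k (by omega), ← ih k i (by omega),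
          ← ih i j (by omega)]
        exact lie_jacobi _ _ _)
    refine ⟨G, fun i j hi hj hij p q ↦ ?_⟩
    obtain rfl : j = N - i := by omega
    exact hG i hi (by omega) p q

/-- The relations of levels 0 to 3 imply those of the half-loop algebra. -/
theorem lie_levels_levels {X J : g →ₗ[ℂ] A} (hX : ∀ p q : g, ⁅X p, X q⁆ = X ⁅p, q⁆)
    (hXJ : ∀ p q : g, ⁅X p, J q⁆ = J ⁅p, q⁆) (h2 : ∀ p q r, level2Expr J p q r = 0)
    (h3 : ∀ p q r s, level3Expr J p q r s = 0) (i j : ℕ) (p q : g) :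
    ⁅levels X J i p, levels X J j q⁆ = levels X J (i + j) ⁅p, q⁆ := by
  induction hN : i + j using Nat.strong_induction_on generalizing i j p q with
  | _ N ih =>
  have swap {i : ℕ} (h : ∀ p q : g, ⁅X p, levels X J i q⁆ = levels X J i ⁅p, q⁆) (p q : g) :
      ⁅levels X J i p, X q⁆ = levels X J i ⁅p, q⁆ := by
    rw [← lie_skew, h, ← map_neg, lie_skew]
  obtain rfl | rfl | hN2 : N = 0 ∨ N = 1 ∨ 2 ≤ N := by omega
  · obtain ⟨rfl, rfl⟩ : i = 0 ∧ j = 0 := by omega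
    exact hX p q
  · obtain ⟨rfl, rfl⟩ | ⟨rfl, rfl⟩ : i = 0 ∧ j = 1 ∨ i = 1 ∧ j = 0 := by omega
    · exact hXJ p q
    · exact swap (i := 1) hXJ p q
  obtain ⟨n, rfl⟩ := Nat.exists_eq_add_of_le' hN2
  have ih' (i j : ℕ) (hij : i + j < n + 2) (p q : g) :
      ⁅levels X J i p, levels X J j q⁆ = levels X J (i + j) ⁅p, q⁆ := ih _ hij i j p q rfl
  obtain ⟨G, hG⟩ := exists_lie_levels_eq h2 h3 hN2 ih'
  have hJn (p q : g) : ⁅J p, levels X J (n + 1) q⁆ = levels X J (n + 2) ⁅p, q⁆ :=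
    lie_levels_succ ⟨G, hG 1 (n + 1) le_rfl (by omega) (by omega)⟩ p q
  have hGn : G = levels X J (n + 2) := linearMap_ext_lie fun p q ↦ by
    rw [← hJn]
    exact (hG 1 (n + 1) le_rfl (by omega) (by omega) p q).symm
  -- By perfectness it suffices to take `q = ⁅r, s⁆`, where `X p` acts on `⁅J r, levels X J (n + 1)
  -- s⁆` by the Leibniz rule.
  have hXn (p q : g) : ⁅X p, levels X J (n + 2) q⁆ = levels X J (n + 2) ⁅p, q⁆ := by
    have := linearMap_ext_lie (f := lieBilin X (levels X J (n + 2)) p)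
      (g := levels X J (n + 2) ∘ₗ (LieModule.toEnd ℂ g g p : g →ₗ[ℂ] g)) fun r s ↦ by
        rw [lieBilin_apply, ← hJn, leibniz_lie, hXJ, hJn]
        have h0 : ⁅X p, levels X J (n + 1) s⁆ = levels X J (n + 1) ⁅p, s⁆ := by
          have := ih' 0 (n + 1) (by omega) p s
          rwa [Nat.zero_add] at this
        rw [h0, hJn, ← map_add]
        exact congrArg _ (leibniz_lie p r s).symm
    exact LinearMap.congr_fun this q
  rcases Nat.eq_zero_or_pos i with rfl | hi
  · obtain rfl : j = n + 2 := by omega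
    exact hXn p q
  rcases Nat.eq_zero_or_pos j with rfl | hj
  · obtain rfl : i = n + 2 := by omega
    exact swap hXn p q
  rw [hG i j hi hj hN, hGn]

end Levels

/-! ### From basis elements to all of `g` -/

section Basis

variable {g : Type u} [LieRing g] [LieAlgebra ℂ g] {A : Type w} [LieRing A] [LieAlgebra ℂ A]
  {ι : Type v} {b : Module.Basis ι ℂ g}

lemma basis_induction (b : Module.Basis ι ℂ g) {P : g → Prop} (hb : ∀ i, P (b i))
    (h0 : P 0) (hadd : ∀ p q, P p → P q → P (p + q)) (hsmul : ∀ (c : ℂ) p, P p → P (c • p))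
    (p : g) : P p := by
  induction b.mem_span p using Submodule.span_induction with
  | mem x hx => obtain ⟨i, rfl⟩ := hx; exact hb i
  | zero => exact h0
  | add x y _ _ hx hy => exact hadd x y hx hy
  | smul c x _ hx => exact hsmul c x hx

lemma level2Expr_eq_zero {J : g →ₗ[ℂ] A} (h : Level2 b J) (p q r : g) :
    level2Expr J p q r = 0 := by
  have cyc (p q r : g) : level2Expr J p q r = level2Expr J q r p := by
    simp only [level2Expr]; abel
  have step {q r : g} (h : ∀ i, level2Expr J (b i) q r = 0) (p : g) : level2Expr J p q r = 0 := by
    refine basis_induction b (P := fun p ↦ level2Expr J p q r = 0) h ?_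
      (fun p p' hp hp' ↦ ?_) (fun c p hp ↦ ?_) p
    · simp [level2Expr]
    · refine Eq.trans ?_ ((congrArg₂ (· + ·) hp hp').trans (add_zero 0))
      simp only [level2Expr, map_add, lie_add, add_lie]
      abel
    · rw [← smul_zero c, ← hp]
      simp only [level2Expr, map_smul, lie_smul, smul_lie, smul_add]
  refine step (fun i ↦ ?_) p
  rw [cyc]
  refine step (fun j ↦ ?_) q
  rw [cyc]
  exact step (fun k ↦ h k i j) r

/-- The symmetries `symm` and `skew` bring each argument to the first slot, so linearity is checked
only there. -/
lemma level3Expr_eq_zero {J : g →ₗ[ℂ] A} (h : Level3 b J) (p q r s : g) :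
    level3Expr J p q r s = 0 := by
  have symm (p q r s : g) : level3Expr J p q r s = level3Expr J r s p q := add_comm _ _
  have skew (p q r s : g) : level3Expr J p q r s = -level3Expr J q p r s := by
    simp only [level3Expr, neg_add, ← lie_skew (J p) (J q), ← lie_skew p q, map_neg, neg_lie,
      lie_neg]
  have step {q r s : g} (h : ∀ i, level3Expr J (b i) q r s = 0) (p : g) :
      level3Expr J p q r s = 0 := by
    refine basis_induction b (P := fun p ↦ level3Expr J p q r s = 0) h ?_
      (fun p p' hp hp' ↦ ?_) (fun c p hp ↦ ?_) p
    · simp [level3Expr]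
    · refine Eq.trans ?_ ((congrArg₂ (· + ·) hp hp').trans (add_zero 0))
      simp only [level3Expr, map_add, lie_add, add_lie]
      abel
    · rw [← smul_zero c, ← hp]
      simp only [level3Expr, map_smul, lie_smul, smul_lie, smul_add]
  refine step (fun i ↦ ?_) p
  rw [skew, neg_eq_zero]
  refine step (fun j ↦ ?_) q
  rw [symm]
  refine step (fun k ↦ ?_) r
  rw [skew, neg_eq_zero]
  refine step (fun l ↦ ?_) s
  rw [skew, neg_eq_zero, symm, skew, neg_eq_zero]
  exact h i j k l

variable [Fintype ι]

/-- The linear map given by a `J` satisfying the level-1 relations. -/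
def Level01.toLinearMap {x : ι → A} {J : g → A} (h : Level01 b x J) : g →ₗ[ℂ] A where
  toFun := J
  map_add' p q := by simpa using h.J_linear 1 1 p q
  map_smul' c p := by simpa using h.J_linear c 0 p 0

lemma sum_structConst_smul (i j : ι) : ∑ k, structConst b i j k • b k = ⁅b i, b j⁆ :=
  b.sum_repr _

lemma Level01.lie_constr_constr {x : ι → A} {J : g → A} (h : Level01 b x J) (p q : g) :
    ⁅b.constr ℂ x p, b.constr ℂ x q⁆ = b.constr ℂ x ⁅p, q⁆ := by
  have : lieBilin (b.constr ℂ x) (b.constr ℂ x) =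
      (LieModule.toEnd ℂ g g : g →ₗ[ℂ] g →ₗ[ℂ] g).compr₂ (b.constr ℂ x) :=
    b.ext fun i ↦ b.ext fun j ↦ by
      change ⁅b.constr ℂ x (b i), b.constr ℂ x (b j)⁆ = b.constr ℂ x ⁅b i, b j⁆
      rw [← sum_structConst_smul, map_sum]
      simp only [map_smul, b.constr_basis, h.lie_x_x]
  exact LinearMap.congr_fun₂ this p q

lemma Level01.lie_constr_J {x : ι → A} {J : g → A} (h : Level01 b x J) (p q : g) :
    ⁅b.constr ℂ x p, h.toLinearMap q⁆ = h.toLinearMap ⁅p, q⁆ := by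
  have : lieBilin (b.constr ℂ x) h.toLinearMap =
      (LieModule.toEnd ℂ g g : g →ₗ[ℂ] g →ₗ[ℂ] g).compr₂ h.toLinearMap :=
    b.ext fun i ↦ b.ext fun j ↦ by
      change ⁅b.constr ℂ x (b i), J (b j)⁆ = h.toLinearMap ⁅b i, b j⁆
      rw [← sum_structConst_smul, map_sum]
      simp only [map_smul, b.constr_basis, h.lie_x_J]
      rfl
  exact LinearMap.congr_fun₂ this p q

end Basis

/-! ### The isomorphism with the half-loop algebra -/

section Isomorphism

variable {g : Type u} [LieRing g] [LieAlgebra ℂ g] {ι : Type v}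
  (b : Module.Basis ι ℂ g)

/-- The evaluation of the free Lie algebra in the half-loop algebra. -/
def freeToLoop : FreeLieAlgebra ℂ (Gen ι g) →ₗ⁅ℂ⁆ LoopAlg g :=
  FreeLieAlgebra.lift ℂ fun
    | .x i => loopElt 0 (b i)
    | .J p => loopElt 1 p

lemma lie_loopElt (m n : ℕ) (p q : g) :
    ⁅loopElt m p, loopElt n q⁆ = loopElt (m + n) ⁅p, q⁆ := by
  rw [loopElt, loopElt, LieAlgebra.ExtendScalars.bracket_tmul, ← pow_add]
  rfl

/-- The linear map `y ↦ y⁽ⁿ⁾`. -/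
def loopEltHom (n : ℕ) : g →ₗ[ℂ] LoopAlg g := TensorProduct.mk ℂ ℂ[X] g (Polynomial.X ^ n)

lemma loopEltHom_apply (n : ℕ) (p : g) : loopEltHom n p = loopElt n p := rfl

@[simp] lemma freeToLoop_freeX (i : ι) : freeToLoop b (freeX g i) = loopElt 0 (b i) :=
  FreeLieAlgebra.lift_of_apply ..

@[simp] lemma freeToLoop_freeJ (p : g) : freeToLoop b (freeJ ι p) = loopElt 1 p :=
  FreeLieAlgebra.lift_of_apply ..

variable [Fintype ι]

lemma mk_eq_zero_of_relator {r : FreeLieAlgebra ℂ (Gen ι g)} (h : Relator b r) :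
    LieSubmodule.Quotient.mk' (relIdeal b) r = 0 :=
  LieSubmodule.Quotient.mk_eq_zero'.mpr (LieSubmodule.subset_lieSpan h)

lemma mk'_lie (r s : FreeLieAlgebra ℂ (Gen ι g)) :
    LieSubmodule.Quotient.mk' (relIdeal b) ⁅r, s⁆ =
      ⁅(LieSubmodule.Quotient.mk' (relIdeal b) r : Presented b),
        (LieSubmodule.Quotient.mk' (relIdeal b) s : Presented b)⁆ := rfl

lemma mk'_freeX (i : ι) : LieSubmodule.Quotient.mk' (relIdeal b) (freeX g i) = presX b i := rfl

lemma mk'_freeJ (p : g) : LieSubmodule.Quotient.mk' (relIdeal b) (freeJ ι p) = presJ b p := rfl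

lemma level01_pres : Level01 b (presX b) (presJ b) where
  lie_x_x i j := by
    simpa only [map_sub, map_sum, map_smul, mk'_lie, mk'_freeX, sub_eq_zero] using
      mk_eq_zero_of_relator b (.level0 i j)
  J_linear μ ν p q := by
    simpa only [map_sub, map_add, map_smul, mk'_lie, mk'_freeJ, sub_eq_zero] using
      mk_eq_zero_of_relator b (.linear μ ν p q)
  lie_x_J i j := by
    simpa only [map_sub, map_sum, map_smul, mk'_lie, mk'_freeX, mk'_freeJ, sub_eq_zero] using
      mk_eq_zero_of_relator b (.level1 i j)

lemma level2_pres : Level2 b (presJ b) := fun i j k ↦ mk_eq_zero_of_relator b (.level2 i j k)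

lemma level3_pres : Level3 b (presJ b) := fun i j k l ↦ mk_eq_zero_of_relator b (.level3 i j k l)

/-- In `g[u]` level 2 becomes the Jacobi identity of `g` in degree 2, and level 3 the skewness of
its bracket in degree 3. -/
lemma freeToLoop_relator {r : FreeLieAlgebra ℂ (Gen ι g)} (h : Relator b r) :
    freeToLoop b r = 0 := by
  cases h with
  | level0 i j =>
    simp only [map_sub, LieHom.map_lie, map_sum, map_smul, freeToLoop_freeX, lie_loopElt]
    simp only [← loopEltHom_apply]
    rw [← sum_structConst_smul, map_sum, sub_eq_zero]
    simp only [map_smul]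
  | linear μ ν p q =>
    simp only [map_sub, map_add, map_smul, freeToLoop_freeJ, ← loopEltHom_apply, sub_self]
  | level1 i j =>
    simp only [map_sub, LieHom.map_lie, map_sum, map_smul, freeToLoop_freeX, freeToLoop_freeJ,
      lie_loopElt]
    simp only [← loopEltHom_apply]
    rw [← sum_structConst_smul, map_sum, sub_eq_zero]
    simp only [map_smul]
  | level2 i j k =>
    simp only [level2Expr, map_add, LieHom.map_lie, freeToLoop_freeJ, lie_loopElt]
    simp only [← loopEltHom_apply]
    rw [← map_add, ← map_add, lie_jacobi, map_zero]
  | level3 i j k l =>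
    simp only [level3Expr, map_add, LieHom.map_lie, freeToLoop_freeJ, lie_loopElt]
    simp only [← loopEltHom_apply]
    rw [← map_add, ← lie_skew ⁅b k, b l⁆, add_neg_cancel, map_zero]

lemma relIdeal_le_ker : relIdeal b ≤ (freeToLoop b).ker :=
  LieSubmodule.lieSpan_le.mpr fun _ hr ↦ LieHom.mem_ker.mpr (freeToLoop_relator b hr)

/-- The map from the presented Lie algebra to the half-loop algebra. -/
def presToLoop : Presented b →ₗ⁅ℂ⁆ LoopAlg g where
  __ := (relIdeal b).toSubmodule.liftQ (freeToLoop b : FreeLieAlgebra ℂ (Gen ι g) →ₗ[ℂ] LoopAlg g)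
    (relIdeal_le_ker b)
  map_lie' {x y} := by
    obtain ⟨x, rfl⟩ := LieSubmodule.Quotient.surjective_mk' _ x
    obtain ⟨y, rfl⟩ := LieSubmodule.Quotient.surjective_mk' _ y
    exact (freeToLoop b).map_lie x y

lemma presToLoop_presX (i : ι) : presToLoop b (presX b i) = loopElt 0 (b i) :=
  freeToLoop_freeX b i

lemma presToLoop_presJ (p : g) : presToLoop b (presJ b p) = loopElt 1 p :=
  freeToLoop_freeJ b p

/-- The elements `y⁽ⁿ⁾` of the presented Lie algebra. -/
def presLevels (n : ℕ) : g →ₗ[ℂ] Presented b :=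
  levels (b.constr ℂ (presX b)) (level01_pres b).toLinearMap n

/-- The linear map from the half-loop algebra to the presented Lie algebra. -/
def loopToPres : LoopAlg g →ₗ[ℂ] Presented b :=
  TensorProduct.lift ((Polynomial.basisMonomials ℂ).constr ℂ (presLevels b))

lemma loopToPres_loopElt (n : ℕ) (p : g) : loopToPres b (loopElt n p) = presLevels b n p := by
  have := (Polynomial.basisMonomials ℂ).constr_basis ℂ (presLevels b) n
  simp only [Polynomial.coe_basisMonomials, ← Polynomial.X_pow_eq_monomial] at this
  rw [loopElt, loopToPres, TensorProduct.lift.tmul, this]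

lemma loopAlg_hom_ext {M : Type*} [AddCommGroup M] [Module ℂ M] {F G : LoopAlg g →ₗ[ℂ] M}
    (h : ∀ n p, F (loopElt n p) = G (loopElt n p)) : F = G := by
  refine TensorProduct.ext ((Polynomial.basisMonomials ℂ).ext fun n ↦ LinearMap.ext fun p ↦ ?_)
  simp only [Polynomial.coe_basisMonomials, ← Polynomial.X_pow_eq_monomial]
  exact h n p

variable [FiniteDimensional ℂ g] [LieAlgebra.IsSimple ℂ g]

lemma lie_presLevels (m n : ℕ) (p q : g) :
    ⁅presLevels b m p, presLevels b n q⁆ = presLevels b (m + n) ⁅p, q⁆ :=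
  lie_levels_levels (level01_pres b).lie_constr_constr (level01_pres b).lie_constr_J
    (level2Expr_eq_zero (b := b) (level2_pres b)) (level3Expr_eq_zero (b := b) (level3_pres b))
    m n p q

lemma loopToPres_lie (s t : LoopAlg g) :
    loopToPres b ⁅s, t⁆ = ⁅loopToPres b s, loopToPres b t⁆ := by
  have : (LieModule.toEnd ℂ (LoopAlg g) (LoopAlg g) :
      LoopAlg g →ₗ[ℂ] LoopAlg g →ₗ[ℂ] LoopAlg g).compr₂ (loopToPres b) =
      lieBilin (loopToPres b) (loopToPres b) :=
    loopAlg_hom_ext fun m p ↦ loopAlg_hom_ext fun n q ↦ by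
      change loopToPres b ⁅loopElt m p, loopElt n q⁆ = _
      rw [lieBilin_apply, lie_loopElt, loopToPres_loopElt, loopToPres_loopElt, loopToPres_loopElt,
        lie_presLevels]
  exact LinearMap.congr_fun₂ this s t

/-- Degree `n + 1` is spanned by brackets of degrees 1 and `n`, so induction on degree applies. -/
lemma presToLoop_presLevels (n : ℕ) (p : g) : presToLoop b (presLevels b n p) = loopElt n p := by
  suffices h : (presToLoop b : Presented b →ₗ[ℂ] LoopAlg g) ∘ₗ presLevels b n = loopEltHom n from
    LinearMap.congr_fun h p
  induction n with
  | zero =>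
    refine b.ext fun i ↦ ?_
    change presToLoop b (b.constr ℂ (presX b) (b i)) = _
    rw [b.constr_basis, presToLoop_presX, loopEltHom_apply]
  | succ n ih =>
    refine linearMap_ext_lie fun p q ↦ ?_
    change presToLoop b (presLevels b (n + 1) ⁅p, q⁆) = _
    have h1 : presToLoop b (presLevels b 1 p) = loopElt 1 p := presToLoop_presJ b p
    have hn : presToLoop b (presLevels b n q) = loopElt n q := LinearMap.congr_fun ih q
    rw [Nat.add_comm n 1, ← lie_presLevels, LieHom.map_lie, h1, hn, lie_loopElt, loopEltHom_apply]

lemma presToLoop_loopToPres (t : LoopAlg g) : presToLoop b (loopToPres b t) = t := by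
  suffices h : (presToLoop b : Presented b →ₗ[ℂ] LoopAlg g) ∘ₗ loopToPres b = LinearMap.id from
    LinearMap.congr_fun h t
  refine loopAlg_hom_ext fun n p ↦ ?_
  change presToLoop b (loopToPres b (loopElt n p)) = loopElt n p
  rw [loopToPres_loopElt, presToLoop_presLevels]

lemma loopToPres_presToLoop (s : Presented b) : loopToPres b (presToLoop b s) = s := by
  obtain ⟨s, rfl⟩ := LieSubmodule.Quotient.surjective_mk' _ s
  -- Both composites are Lie homomorphisms out of the free Lie algebra, so comparing generators
  -- suffices.
  let F : FreeLieAlgebra ℂ (Gen ι g) →ₗ⁅ℂ⁆ Presented b :=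
    { loopToPres b ∘ₗ (freeToLoop b : FreeLieAlgebra ℂ (Gen ι g) →ₗ[ℂ] LoopAlg g) with
      map_lie' := fun {x y} ↦ by
        change loopToPres b (freeToLoop b ⁅x, y⁆) = _
        rw [LieHom.map_lie, loopToPres_lie]
        rfl }
  let G : FreeLieAlgebra ℂ (Gen ι g) →ₗ⁅ℂ⁆ Presented b :=
    { (LieSubmodule.Quotient.mk' (relIdeal b) :
        FreeLieAlgebra ℂ (Gen ι g) →ₗ[ℂ] FreeLieAlgebra ℂ (Gen ι g) ⧸ relIdeal b) with
      map_lie' := rfl }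
  have : F = G := FreeLieAlgebra.hom_ext fun
    | .x i => by
      change loopToPres b (freeToLoop b (freeX g i)) = presX b i
      rw [freeToLoop_freeX, loopToPres_loopElt]
      exact b.constr_basis ℂ _ i
    | .J p => by
      change loopToPres b (freeToLoop b (freeJ ι p)) = presJ b p
      rw [freeToLoop_freeJ, loopToPres_loopElt]
      rfl
  exact LieHom.congr_fun this s

/-- The presented Lie algebra is isomorphic to the half-loop algebra. -/
def presEquivLoop : Presented b ≃ₗ⁅ℂ⁆ LoopAlg g where
  __ := presToLoop b
  invFun := loopToPres b
  left_inv := loopToPres_presToLoop b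
  right_inv := presToLoop_loopToPres b

end Isomorphism

end HalfLoop
end

theorem proposition3p1 {g : Type u} [LieRing g] [LieAlgebra ℂ g] [FiniteDimensional ℂ g]
    [LieAlgebra.IsSimple ℂ g] {ι : Type v} [Fintype ι] (b : Module.Basis ι ℂ g) :
    (∃ Φ : HalfLoop.Presented b ≃ₗ⁅ℂ⁆ HalfLoop.LoopAlg g,
      (∀ a : ι, Φ (HalfLoop.presX b a) = HalfLoop.loopElt 0 (b a)) ∧
      (∀ a : ι, Φ (HalfLoop.presJ b (b a)) = HalfLoop.loopElt 1 (b a))) ∧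
    (LieAlgebra.rank ℂ g = 1 →
      ∀ (A : Type w) [LieRing A] [LieAlgebra ℂ A] (J : g →ₗ[ℂ] A), HalfLoop.Level2 b J) ∧
    (2 ≤ LieAlgebra.rank ℂ g →
      ∀ (A : Type w) [LieRing A] [LieAlgebra ℂ A] (x : ι → A) (J : g → A),
        HalfLoop.Level01 b x J → HalfLoop.Level2 b J → HalfLoop.Level3 b J) := by
  obtain ⟨H, hH, hrank⟩ := HalfLoop.exists_isCartanSubalgebra_finrank_eq_rank ℂ g
  refine ⟨⟨HalfLoop.presEquivLoop b, HalfLoop.presToLoop_presX b,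
    fun a ↦ HalfLoop.presToLoop_presJ b (b a)⟩, fun h1 A _ _ J i j k ↦ ?_,
    fun h2 A _ _ x J h01 hJ2 i j k l ↦ ?_⟩
  · obtain ⟨h, e, f, ht, hspan⟩ :=
      HalfLoop.exists_isSl2Triple_span_of_finrank_eq_one (hrank.trans h1)
    exact HalfLoop.level2Expr_eq_zero_of_isSl2Triple ht hspan J _ _ _
  · have hJ := HalfLoop.level2Expr_eq_zero (b := b) (J := h01.toLinearMap) hJ2
    -- From level 1 on, `levels` depends only on `J`, so level 0 may be filled with `0`.
    have hcyc := HalfLoop.isCyclic_lieBilin_levels_two (X := 0) hJ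
    have := HalfLoop.level3Expr_eq_neg (X := 0) hJ (b i) (b j) (b k) (b l)
    rw [hcyc.skew H (h2.trans_eq hrank.symm) ⁅b k, b l⁆, neg_add_cancel, neg_zero] at this
    exact this
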